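/- Let $\varphi$ be the standard Gaussian density, let $k\ge 2$ be an integer, and let $F_\infty$ have the probability density $p_\infty(x)=|x|^k\varphi(x)\big/\int_{\mathbb R}|y|^k\varphi(y)\,dy$. Let $F$ be a real random variable with $P(F\neq 0)=1$ and $E[F^2]=k+1$, and let $F^\star$ be a random variable, defined on the same probability space as $F$, that has the generalized $k$-radial-bias distribution of $F$: for every differentiable $f:\mathbb R\to\mathbb R$ such that both expectations exist (that is, both integrands are integrable), $$\frac{E[F^2]}{k+1}\,E\left[\frac{f'(F^\star)}{|F^\star|^k}\right]=E\left[\frac{F f(F)}{|F|^{k}}\right].$$ Put $$a_r(k)=2^r\,\frac{\Gamma(k/2+1)}{\Gamma(k/2-r+1)},$$ and let $d_W(F,F_\infty)=\sup_h|E h(F)-E h(F_\infty)|$ be the Wasserstein distance of the laws, the supremum being over all $h:\mathbb R\to\mathbb R$ with Lipschitz constant at most $1$. Then the following bounds hold (expectations on the right are of nonnegative random variables and may be $+\infty$). If $k=2\ell$ is even, then $$\begin{aligned} d_W(F,F_\infty)\le{}&\sum_{j=0}^{\ell}a_{\ell-j}(2\ell)\Big(E\big|F^{2j}-(F^\star)^{2j}\big|+2E\big[|F|^{2j}|F-F^\star|\big]\Big)\\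 &+\sum_{j=1}^{\ell}a_j(2\ell)\Big(E\Big|\frac1{F^{2j-1}}-\frac1{(F^\star)^{2j-1}}\Big|+E\Big[\frac{1}{|F|^{2j-1}}|F-F^\star|\Big]\Big).\end{aligned}$$ If $k=2\ell-1$ is odd, then $$\begin{aligned} d_W(F,F_\infty)\le{}&\sum_{j=1}^{\ell}a_{\ell-j}(2\ell-1)\Big(E\big|F^{2j-1}-(F^\star)^{2j-1}\big|+2E\big[|F|^{2j-1}|F-F^\star|\big]\Big)\\ &+\sum_{j=1}^{\ell-1}a_j(2\ell-1)\Big(E\Big|\frac1{F^{2j-1}}-\frac1{(F^\star)^{2j-1}}\Big|+E\Big[\frac{1}{|F|^{2j-1}}|F-F^\star|\Big]\Big)\\ &+3a_\ell(2\ell-1)\,E\Big[\Big(2+\frac{2}{|F|^{2(\ell-1)}}+\frac1{|F^\star|^{2(\ell-1)}}\Big)|F-F^\star|\Big]\\ &+3a_\ell(2\ell-1)\,E\Big[\big(|F|+|F|^{2\ell-1}\big)\Big|\frac1{F^{2\ell-1}}-\frac1{(F^\star)^{2\ell-1}}\Big|\Big].\end{aligned}$$ -/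

import Mathlib

open MeasureTheory ProbabilityTheory
open scoped ENNReal

noncomputable section

/-- The normalising constant `∫ |x|^k φ(x) dx`, where `φ` is the standard Gaussian density. -/
def radialConst (k : ℕ) : ℝ := ∫ x : ℝ, |x| ^ k * gaussianPDFReal 0 1 x

/-- The density `p_∞(x) = |x|^k φ(x) / ∫ |y|^k φ(y) dy`. -/
def radialDensity (k : ℕ) (x : ℝ) : ℝ := |x| ^ k * gaussianPDFReal 0 1 x / radialConst k

/-- The law of `F_∞`, the probability measure with density `p_∞ ∝ |x|^k φ`. -/
def radialMeasure (k : ℕ) : Measure ℝ :=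
  volume.withDensity fun x => ENNReal.ofReal (radialDensity k x)

/-- Wasserstein distance of two laws on `ℝ` (with finite first moments):
the supremum of `|∫ h dμ - ∫ h dν|` over all functions `h` with Lipschitz constant at most `1`. -/
def wassersteinDist (μ ν : Measure ℝ) : ℝ≥0∞ :=
  ⨆ (h : ℝ → ℝ) (_ : LipschitzWith 1 h), ENNReal.ofReal |(∫ x, h x ∂μ) - ∫ x, h x ∂ν|

/-- `Fs` has the generalized `k`-radial-bias distribution of `F`, i.e.
`σ² E[f'(Fs) / |Fs|^k] = E[F f(F) / |F|^k]` with `σ² = E[F²] / (k + 1)`, for all differentiable `f`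
such that both expectations exist. -/
def IsRadialBias {Ω : Type*} [MeasurableSpace Ω] (k : ℕ) (P : Measure Ω) (F Fs : Ω → ℝ) : Prop :=
  ∀ f : ℝ → ℝ, Differentiable ℝ f →
    Integrable (fun ω => deriv f (Fs ω) / |Fs ω| ^ k) P →
    Integrable (fun ω => F ω * f (F ω) / |F ω| ^ k) P →
    (∫ ω, F ω ^ 2 ∂P) / ((k : ℝ) + 1) * ∫ ω, deriv f (Fs ω) / |Fs ω| ^ k ∂P
      = ∫ ω, F ω * f (F ω) / |F ω| ^ k ∂P

/-- The expectation, possibly `∞`, of a nonnegative random variable. -/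
def nonnegExp {Ω : Type*} [MeasurableSpace Ω] (P : Measure Ω) (X : Ω → ℝ) : ℝ≥0∞ :=
  ∫⁻ ω, ENNReal.ofReal (X ω) ∂P

/-- The coefficient `a_r(k) = 2^r Γ(k/2 + 1) / Γ(k/2 - r + 1)`. -/
def radialCoeff (r k : ℕ) : ℝ :=
  Real.Gamma ((k : ℝ) / 2 + 1) / Real.Gamma ((k : ℝ) / 2 - r + 1) * 2 ^ r

end

/-! ### Tail moments of the Gaussian weight -/

open Set Filter Topology

/-! Stein's method. For 1-Lipschitz `h` centred under the limit law, `steinSolution` gives `f` with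
`f' - x f = |x|^k h`. Put `T(x) = f'(x)/|x|^k = h(x) + x f(x)/|x|^k` for `x ≠ 0` (`steinTest`). The
radial-bias identity then reads `E h(F) = E[T(F) - T(F⋆)]`, so a pointwise bound on `T(x) - T(y)`
for nonzero `x`, `y` is enough.

Factor `x f(x)/|x|^k = r(x) s(x)`. Up to sign, `s` (`steinRatio`) is the Stein integral of `h` over
that of the identity; it is bounded by 1 (`abs_steinRatio_le`) and 1-Lipschitz
(`abs_steinRatio_sub_le`). The Lipschitz bound is the analytic core: it rests on log-concavity of an
integrated Gaussian tail and on `k ≥ 2`. The factor `r` (`radialRatio`) is explicit. Integration by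
parts gives `r_{k+2} = x + (k+2) r_k / x²`, so `r_k` is `x` plus odd negative powers of `x` with
coefficients `a_j(k)`, and for odd `k` one further term with the Mills ratio. Differencing the
products gives the summands of the theorem.

Using the bias identity for `f` requires negative moments of `F` and `F⋆`. If the right-hand side is
infinite there is nothing to prove; otherwise its finite terms start a bootstrap.
`integrable_inv_pow_of_isRadialBias` yields `E|F⋆|^{-m} < ∞` from `E|F|^{2-m} < ∞`, and a finite
difference term carries the moment back from `F⋆` to `F`. -/

/-- The unnormalised Gaussian weight `exp (-t ^ 2 / 2)`. -/
noncomputable def gaussWeight (t : ℝ) : ℝ := Real.exp (-t ^ 2 / 2)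

/-- The tail moment `∫_x^∞ t ^ j exp (-t ^ 2 / 2) dt`. -/
noncomputable def gaussTail (j : ℕ) (x : ℝ) : ℝ := ∫ t in Ioi x, t ^ j * gaussWeight t

lemma gaussWeight_pos (t : ℝ) : 0 < gaussWeight t := Real.exp_pos _

lemma gaussWeight_neg (t : ℝ) : gaussWeight (-t) = gaussWeight t := by simp [gaussWeight]

lemma continuous_gaussWeight : Continuous gaussWeight := by unfold gaussWeight; fun_prop

lemma gaussWeight_abs (t : ℝ) : gaussWeight |t| = gaussWeight t := by simp [gaussWeight]

lemma hasDerivAt_gaussWeight (t : ℝ) : HasDerivAt gaussWeight (-t * gaussWeight t) t := by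
  have h : HasDerivAt (fun t : ℝ => -t ^ 2 / 2) (-t) t := by
    exact ((hasDerivAt_pow 2 t).fun_neg.div_const 2).congr_deriv (by push_cast; ring)
  exact h.exp.congr_deriv (by simp only [gaussWeight]; ring)

lemma integrable_pow_mul_gaussWeight (j : ℕ) : Integrable fun t => t ^ j * gaussWeight t := by
  have h := integrable_rpow_mul_exp_neg_mul_sq (b := 1 / 2) (by norm_num) (s := j)
    (by have : (0 : ℝ) ≤ j := by positivity
        linarith)
  refine h.congr (ae_of_all _ fun t => ?_)
  simp only [gaussWeight, Real.rpow_natCast]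
  congr 2
  ring

lemma tendsto_pow_mul_gaussWeight (j : ℕ) :
    Tendsto (fun t => t ^ j * gaussWeight t) atTop (𝓝 0) := by
  have h := (tendsto_rpow_abs_mul_exp_neg_mul_sq_cocompact (a := 1 / 2) (by norm_num) j).mono_left
    atTop_le_cocompact
  refine h.congr' ?_
  filter_upwards [eventually_ge_atTop 0] with t ht
  simp only [gaussWeight, Real.rpow_natCast, abs_of_nonneg ht]
  congr 2
  ring

lemma hasDerivAt_integral_Iic {g : ℝ → ℝ} (hg : Continuous g) (hi : Integrable g) (x : ℝ) :
    HasDerivAt (fun x => ∫ t in Iic x, g t) (g x) x := by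
  have h1 : HasDerivAt (fun x => (∫ t in Iic (0 : ℝ), g t) + ∫ t in (0 : ℝ)..x, g t) (g x) x :=
    (intervalIntegral.integral_hasDerivAt_right (hg.intervalIntegrable _ _)
      (hg.stronglyMeasurableAtFilter _ _) hg.continuousAt).const_add _
  refine h1.congr_of_eventuallyEq (Eventually.of_forall fun y => ?_)
  have := intervalIntegral.integral_Iic_sub_Iic (a := 0) (b := y) hi.integrableOn hi.integrableOn
  simp only
  linarith

lemma integral_Iic_add_Ioi_eq {g : ℝ → ℝ} (hi : Integrable g) (x : ℝ) :
    (∫ t in Iic x, g t) + ∫ t in Ioi x, g t = ∫ t, g t := by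
  rw [← compl_Iic]
  exact integral_add_compl measurableSet_Iic hi

lemma hasDerivAt_integral_Ioi {g : ℝ → ℝ} (hg : Continuous g) (hi : Integrable g) (x : ℝ) :
    HasDerivAt (fun x => ∫ t in Ioi x, g t) (-g x) x := by
  refine ((hasDerivAt_integral_Iic hg hi x).const_sub (∫ t, g t)).congr_of_eventuallyEq
    (Eventually.of_forall fun y => ?_)
  have := integral_Iic_add_Ioi_eq hi y
  simp only
  linarith

lemma gaussTail_one (x : ℝ) : gaussTail 1 x = gaussWeight x := by
  have h := integral_Ioi_of_hasDerivAt_of_tendsto' (a := x) (f := fun t => -gaussWeight t)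
    (f' := fun t => t ^ 1 * gaussWeight t) (m := 0)
    (fun t _ => (hasDerivAt_gaussWeight t).fun_neg.congr_deriv (by ring))
    (integrable_pow_mul_gaussWeight 1).integrableOn
    (by simpa using (tendsto_pow_mul_gaussWeight 0).neg)
  simpa [gaussTail] using h

lemma gaussTail_add_two (j : ℕ) (x : ℝ) :
    gaussTail (j + 2) x = x ^ (j + 1) * gaussWeight x + (j + 1) * gaussTail j x := by
  have h := integral_Ioi_of_hasDerivAt_of_tendsto' (a := x)
    (f := fun t => -(t ^ (j + 1) * gaussWeight t))
    (f' := fun t => t ^ (j + 2) * gaussWeight t - (j + 1) * (t ^ j * gaussWeight t)) (m := 0)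
    (fun t _ => by
      refine ((hasDerivAt_pow (j + 1) t).fun_mul (hasDerivAt_gaussWeight t)).fun_neg.congr_deriv ?_
      rw [Nat.add_sub_cancel]
      push_cast
      ring)
    ((integrable_pow_mul_gaussWeight (j + 2)).sub
      ((integrable_pow_mul_gaussWeight j).const_mul _)).integrableOn
    (by simpa using (tendsto_pow_mul_gaussWeight (j + 1)).neg)
  rw [integral_sub (integrable_pow_mul_gaussWeight _).integrableOn
    ((integrable_pow_mul_gaussWeight j).const_mul _).integrableOn, integral_const_mul] at h
  simp only [gaussTail]
  linarith

lemma hasDerivAt_gaussTail (j : ℕ) (x : ℝ) :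
    HasDerivAt (gaussTail j) (-(x ^ j * gaussWeight x)) x :=
  hasDerivAt_integral_Ioi ((continuous_pow j).mul continuous_gaussWeight)
    (integrable_pow_mul_gaussWeight j) x

lemma gaussTail_nonneg (j : ℕ) {x : ℝ} (hx : 0 ≤ x) : 0 ≤ gaussTail j x :=
  setIntegral_nonneg measurableSet_Ioi fun t ht =>
    mul_nonneg (pow_nonneg (hx.trans (le_of_lt ht)) _) (gaussWeight_pos t).le

lemma gaussTail_pos (j : ℕ) {x : ℝ} (hx : 0 ≤ x) : 0 < gaussTail j x := by
  have hpos : ∀ t ∈ Ioi x, 0 < t ^ j * gaussWeight t := fun t ht =>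
    mul_pos (pow_pos (hx.trans_lt ht) _) (gaussWeight_pos t)
  rw [gaussTail, setIntegral_pos_iff_support_of_nonneg_ae
    ((ae_restrict_iff' measurableSet_Ioi).2 (ae_of_all _ fun t ht => (hpos t ht).le))
    (integrable_pow_mul_gaussWeight j).integrableOn]
  have : Function.support (fun t => t ^ j * gaussWeight t) ∩ Ioi x = Ioi x :=
    inter_eq_right.2 fun t ht => (hpos t ht).ne'
  rw [this]
  simp

lemma gaussTail_antitone (j : ℕ) {x : ℝ} (hx : 0 ≤ x) : gaussTail j x ≤ gaussTail j 0 :=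
  setIntegral_mono_set (integrable_pow_mul_gaussWeight j).integrableOn
    ((ae_restrict_iff' measurableSet_Ioi).2 (ae_of_all _ fun t ht =>
      mul_nonneg (pow_nonneg (le_of_lt ht) _) (gaussWeight_pos t).le))
    (Ioi_subset_Ioi hx).eventuallyLE

lemma mul_gaussTail_le (j : ℕ) {x : ℝ} (hx : 0 ≤ x) : x * gaussTail j x ≤ gaussTail (j + 1) x := by
  rw [gaussTail, gaussTail, ← integral_const_mul]
  refine setIntegral_mono_on ((integrable_pow_mul_gaussWeight j).const_mul _).integrableOn
    (integrable_pow_mul_gaussWeight _).integrableOn measurableSet_Ioi fun t ht => ?_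
  have h0 : 0 ≤ t ^ j * gaussWeight t :=
    mul_nonneg (pow_nonneg (hx.trans (le_of_lt ht)) _) (gaussWeight_pos t).le
  calc x * (t ^ j * gaussWeight t) ≤ t * (t ^ j * gaussWeight t) :=
        mul_le_mul_of_nonneg_right (le_of_lt ht) h0
    _ = t ^ (j + 1) * gaussWeight t := by ring

/-- Cauchy–Schwarz for `1` and `t` under the weight `t^j exp(-t²/2)` on `(x, ∞)`, obtained by
integrating `(a t - b)²` and choosing `a`, `b` to be the moments of order `j` and `j + 1`. -/
lemma gaussTail_sq_le (j : ℕ) {x : ℝ} (hx : 0 ≤ x) :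
    gaussTail (j + 1) x ^ 2 ≤ gaussTail j x * gaussTail (j + 2) x := by
  have key : ∀ a b : ℝ, 0 ≤ a ^ 2 * gaussTail (j + 2) x - 2 * a * b * gaussTail (j + 1) x
      + b ^ 2 * gaussTail j x := by
    intro a b
    have h : 0 ≤ ∫ t in Ioi x, (a ^ 2 * (t ^ (j + 2) * gaussWeight t)
        - 2 * a * b * (t ^ (j + 1) * gaussWeight t) + b ^ 2 * (t ^ j * gaussWeight t)) := by
      refine setIntegral_nonneg measurableSet_Ioi fun t ht => ?_
      have : 0 ≤ (a * t - b) ^ 2 * (t ^ j * gaussWeight t) :=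
        mul_nonneg (sq_nonneg _)
          (mul_nonneg (pow_nonneg (hx.trans (le_of_lt ht)) _) (gaussWeight_pos t).le)
      convert this using 1
      ring
    have i0 := ((integrable_pow_mul_gaussWeight j).const_mul (b ^ 2)).integrableOn (s := Ioi x)
    have i1 := ((integrable_pow_mul_gaussWeight (j + 1)).const_mul (2 * a * b)).integrableOn
      (s := Ioi x)
    have i2 := ((integrable_pow_mul_gaussWeight (j + 2)).const_mul (a ^ 2)).integrableOn
      (s := Ioi x)
    rw [integral_add (Integrable.sub' i2 i1) i0, integral_sub i2 i1, integral_const_mul, integral_const_mul,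
      integral_const_mul] at h
    exact h
  have hp := gaussTail_pos j hx
  have h := key (gaussTail j x) (gaussTail (j + 1) x)
  have h2 : 0 ≤ gaussTail j x * (gaussTail j x * gaussTail (j + 2) x - gaussTail (j + 1) x ^ 2) := by
    convert h using 1
    ring
  have := nonneg_of_mul_nonneg_right h2 hp
  linarith

/-- Log-concavity of the integrated tail of the weight `t ^ (n + 1) * gaussWeight t`. -/
lemma pow_mul_gaussWeight_mul_le (n : ℕ) {x : ℝ} (hx : 0 ≤ x) :
    x ^ (n + 1) * gaussWeight x * (gaussTail (n + 2) x - x * gaussTail (n + 1) x)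
      ≤ gaussTail (n + 1) x ^ 2 := by
  have hD := gaussTail_add_two n x
  have hE := gaussTail_add_two (n + 1) x
  have c1 := gaussTail_sq_le n hx
  have c2 := gaussTail_sq_le (n + 1) hx
  have hN := gaussTail_pos n hx
  push_cast at hD hE
  set p := x ^ (n + 1) * gaussWeight x
  have hE' : gaussTail (n + 1 + 2) x = x * p + (n + 1 + 1) * gaussTail (n + 1) x := by
    rw [hE]; simp only [p]; ring
  rw [hE'] at c2
  have hn : (0 : ℝ) ≤ n := by positivity
  have c1' := mul_le_mul_of_nonneg_left c1 (by positivity : (0 : ℝ) ≤ n + 1)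
  -- Writing `T_j` for the tails, this replaces `p T_{n+2}` by `T_{n+2}² - (n+1) T_n T_{n+2}`.
  -- Cauchy–Schwarz bounds `T_{n+2}²` above through `c2` and `T_n T_{n+2}` below by `T_{n+1}²`; the
  -- leftover is a single `T_{n+1}²`.
  have : gaussTail (n + 2) x * (p - gaussTail (n + 2) x)
      = - ((n + 1) * (gaussTail n x * gaussTail (n + 2) x)) := by rw [hD]; ring
  change gaussTail (n + 2) x ^ 2 ≤ _ at c2
  nlinarith

lemma sq_mul_gaussTail_le (n : ℕ) {x : ℝ} (hx : 0 ≤ x) :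
    x ^ 2 * gaussTail (n + 1) x ≤ x ^ (n + 2) * gaussWeight x + n * gaussTail (n + 1) x := by
  cases n with
  | zero => simp [gaussTail_one]
  | succ n =>
    have h := gaussTail_add_two n x
    have h1 := mul_gaussTail_le n hx
    have h2 := mul_gaussTail_le (n + 1) hx
    have hn : (0 : ℝ) ≤ n + 1 := by positivity
    have h3 : x ^ 2 * gaussTail n x ≤ gaussTail (n + 2) x := by
      have := mul_le_mul_of_nonneg_left h1 hx
      nlinarith
    have h4 := mul_le_mul_of_nonneg_left h3 hn
    push_cast
    calc x ^ 2 * gaussTail (n + 2) x = x ^ (n + 1 + 2) * gaussWeight x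
          + (n + 1) * (x ^ 2 * gaussTail n x) := by rw [h]; ring
      _ ≤ _ := by linarith

/-- Cauchy–Schwarz reduces this to `(x² + 2) T_{n+1} ≤ T_{n+3}`. The recursion supplies `n + 2`
copies of `T_{n+1}`, and `sq_mul_gaussTail_le` uses up only `n` of them. This is where the index
must be at least 2. -/
lemma sq_add_two_mul_gaussTail_sq_le (n : ℕ) {x : ℝ} (hx : 0 ≤ x) :
    (x ^ 2 + 2) * gaussTail (n + 2) x ^ 2 ≤ gaussTail (n + 3) x ^ 2 := by
  have c1 := gaussTail_sq_le (n + 1) hx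
  have h := sq_mul_gaussTail_le n hx
  have hD := gaussTail_add_two (n + 1) x
  push_cast at hD
  have hDp := gaussTail_pos (n + 3) hx
  have h1 : (x ^ 2 + 2) * gaussTail (n + 1) x ≤ gaussTail (n + 3) x := by
    change gaussTail (n + 3) x = x ^ (n + 2) * _ + _ at hD
    linarith
  calc (x ^ 2 + 2) * gaussTail (n + 2) x ^ 2
      ≤ (x ^ 2 + 2) * (gaussTail (n + 1) x * gaussTail (n + 3) x) :=
        mul_le_mul_of_nonneg_left c1 (by positivity)
    _ = ((x ^ 2 + 2) * gaussTail (n + 1) x) * gaussTail (n + 3) x := by ring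
    _ ≤ gaussTail (n + 3) x * gaussTail (n + 3) x := mul_le_mul_of_nonneg_right h1 hDp.le
    _ = _ := by ring

/-- Last inequality of the Lipschitz bound for `steinRatio`. For `m = D / Q` it says `x + m ≤ m²`,
which follows from `m² ≥ x² + 2`. -/
lemma mul_sq_add_mul_le_gaussTail_sq (n : ℕ) {x : ℝ} (hx : 0 ≤ x) :
    x * gaussTail (n + 2) x ^ 2 + gaussTail (n + 2) x * gaussTail (n + 3) x
      ≤ gaussTail (n + 3) x ^ 2 := by
  have hQ := gaussTail_pos (n + 2) hx
  have hD := gaussTail_pos (n + 3) hx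
  have h := sq_add_two_mul_gaussTail_sq_le n hx
  set Q := gaussTail (n + 2) x
  set D := gaussTail (n + 3) x
  obtain ⟨m, hm⟩ : ∃ m, D = m * Q := ⟨D / Q, by field_simp⟩
  have hm0 : 0 < m := by
    rw [hm] at hD
    exact pos_of_mul_pos_left hD hQ.le
  have hm2 : x ^ 2 + 2 ≤ m ^ 2 := by
    rw [hm] at h
    have : (x ^ 2 + 2) * Q ^ 2 ≤ m ^ 2 * Q ^ 2 := by linarith [mul_pow m Q 2]
    exact le_of_mul_le_mul_right this (by positivity)
  have hxm : x + m ≤ m ^ 2 := by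
    by_contra hc
    push Not at hc
    have h1 : m ^ 2 - x < m := by linarith
    have h2 : 0 ≤ x ^ 2 + 2 - x := by nlinarith [sq_nonneg (x - 1)]
    have h3 : (m ^ 2 - x) ^ 2 < m ^ 2 := by
      apply sq_lt_sq'
      · linarith
      · exact h1
    have h4 : m ^ 2 - x ≥ x ^ 2 + 2 - x := by linarith
    -- With `s = m²`, `h3` says `s² - (2x+1)s + x² < 0`. This quadratic is increasing for `s ≥ x² +
    -- 2`, and at `x² + 2` equals `(x(x-1))² + 3x² - 4x + 2 > 0`.
    nlinarith [mul_nonneg (sub_nonneg.2 hm2) (by nlinarith : 0 ≤ m ^ 2 + (x ^ 2 + 2) - 2 * x - 1),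
      sq_nonneg (x * (x - 1)), sq_nonneg (3 * x - 2)]
  rw [hm]
  nlinarith [mul_le_mul_of_nonneg_right hxm (sq_nonneg Q)]

/-! ### Radial weight and Stein integrals -/

/-- The unnormalised radial density `|t| ^ k exp (-t ^ 2 / 2)`. -/
noncomputable def radialWeight (k : ℕ) (t : ℝ) : ℝ := |t| ^ k * gaussWeight t

/-- The integral `∫_x^∞ t |t| ^ k exp (-t ^ 2 / 2) dt`, an even function of `x`. -/
noncomputable def radialTail (k : ℕ) (x : ℝ) : ℝ := ∫ t in Ioi x, t * radialWeight k t

/-- The integral of `h` up to `x` against the unnormalised radial density. -/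
noncomputable def steinIntegral (k : ℕ) (h : ℝ → ℝ) (x : ℝ) : ℝ :=
  ∫ t in Iic x, h t * radialWeight k t

lemma radialWeight_nonneg (k : ℕ) (t : ℝ) : 0 ≤ radialWeight k t :=
  mul_nonneg (pow_nonneg (abs_nonneg t) _) (gaussWeight_pos t).le

lemma radialWeight_neg (k : ℕ) (t : ℝ) : radialWeight k (-t) = radialWeight k t := by
  simp [radialWeight, gaussWeight_neg]

lemma radialWeight_of_nonneg (k : ℕ) {t : ℝ} (ht : 0 ≤ t) :
    radialWeight k t = t ^ k * gaussWeight t := by rw [radialWeight, abs_of_nonneg ht]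

lemma continuous_radialWeight (k : ℕ) : Continuous (radialWeight k) :=
  (continuous_abs.pow k).mul continuous_gaussWeight

lemma integrable_radialWeight (k : ℕ) : Integrable (radialWeight k) := by
  refine (integrable_pow_mul_gaussWeight k).norm.congr (ae_of_all _ fun t => ?_)
  simp [radialWeight, abs_of_pos (gaussWeight_pos t)]

lemma integrable_id_mul_radialWeight (k : ℕ) : Integrable fun t => t * radialWeight k t := by
  refine (integrable_radialWeight (k + 1)).mono'
    (continuous_id.mul (continuous_radialWeight k)).aestronglyMeasurable (ae_of_all _ fun t => ?_)
  rw [norm_mul, Real.norm_eq_abs, Real.norm_of_nonneg (radialWeight_nonneg k t)]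
  simp only [radialWeight]
  rw [pow_succ]
  exact le_of_eq (by ring)

lemma abs_sub_le_of_lipschitz {h : ℝ → ℝ} (hh : LipschitzWith 1 h) (x y : ℝ) :
    |h x - h y| ≤ |x - y| := by
  simpa [Real.dist_eq] using hh.dist_le_mul x y

lemma integrable_lipschitz_mul_radialWeight (k : ℕ) {h : ℝ → ℝ} (hh : LipschitzWith 1 h) :
    Integrable fun t => h t * radialWeight k t := by
  refine (((integrable_radialWeight k).const_mul |h 0|).add
    (integrable_id_mul_radialWeight k).norm).mono'
    (hh.continuous.mul (continuous_radialWeight k)).aestronglyMeasurable (ae_of_all _ fun t => ?_)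
  have h1 : |h t| ≤ |h 0| + |t| := by
    have := abs_sub_le_of_lipschitz hh t 0
    have h2 := abs_sub_abs_le_abs_sub (h t) (h 0)
    rw [sub_zero] at this
    linarith
  simp only [Pi.add_apply]
  rw [norm_mul, norm_mul, Real.norm_eq_abs, Real.norm_of_nonneg (radialWeight_nonneg k t),
    Real.norm_eq_abs, ← add_mul]
  exact mul_le_mul_of_nonneg_right h1 (radialWeight_nonneg k t)

lemma integral_id_mul_radialWeight (k : ℕ) : ∫ t, t * radialWeight k t = 0 := by
  have h := integral_neg_eq_self (fun t => t * radialWeight k t) volume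
  simp only [radialWeight_neg, neg_mul, integral_neg] at h
  linarith

lemma integral_Iic_id_mul_radialWeight (k : ℕ) (x : ℝ) :
    ∫ t in Iic x, t * radialWeight k t = -radialTail k x := by
  have h := integral_Iic_add_Ioi_eq (integrable_id_mul_radialWeight k) x
  rw [integral_id_mul_radialWeight] at h
  rw [radialTail]
  linarith

lemma radialTail_neg (k : ℕ) (x : ℝ) : radialTail k (-x) = radialTail k x := by
  have h := integral_comp_neg_Iic x fun t => t * radialWeight k t
  simp only [radialWeight_neg, neg_mul, integral_neg, integral_Iic_id_mul_radialWeight, neg_neg] at h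
  exact h.symm

lemma radialTail_of_nonneg (k : ℕ) {x : ℝ} (hx : 0 ≤ x) : radialTail k x = gaussTail (k + 1) x := by
  refine setIntegral_congr_fun measurableSet_Ioi fun t ht => ?_
  simp only [radialWeight_of_nonneg k (hx.trans (le_of_lt ht))]
  ring

lemma radialTail_abs (k : ℕ) (x : ℝ) : radialTail k |x| = radialTail k x := by
  rcases abs_choice x with h | h <;> rw [h]
  exact radialTail_neg k x

lemma radialTail_eq (k : ℕ) (x : ℝ) : radialTail k x = gaussTail (k + 1) |x| := by
  rw [← radialTail_of_nonneg k (abs_nonneg x), radialTail_abs]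

lemma radialTail_pos (k : ℕ) (x : ℝ) : 0 < radialTail k x := by
  rw [radialTail_eq]
  exact gaussTail_pos _ (abs_nonneg x)

lemma hasDerivAt_radialTail (k : ℕ) (x : ℝ) :
    HasDerivAt (radialTail k) (-(x * radialWeight k x)) x :=
  hasDerivAt_integral_Ioi (continuous_id.mul (continuous_radialWeight k))
    (integrable_id_mul_radialWeight k) x

lemma integral_Ioi_radialWeight (k : ℕ) {x : ℝ} (hx : 0 ≤ x) :
    ∫ t in Ioi x, radialWeight k t = gaussTail k x :=
  setIntegral_congr_fun measurableSet_Ioi fun _ ht =>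
    radialWeight_of_nonneg k (hx.trans (le_of_lt ht))

lemma integral_radialWeight (k : ℕ) : ∫ t, radialWeight k t = 2 * gaussTail k 0 := by
  have h := integral_comp_neg_Iic 0 (radialWeight k)
  simp only [radialWeight_neg, neg_zero] at h
  have h2 := integral_Iic_add_Ioi_eq (integrable_radialWeight k) 0
  rw [h, integral_Ioi_radialWeight k le_rfl] at h2
  linarith

lemma hasDerivAt_steinIntegral (k : ℕ) {h : ℝ → ℝ} (hh : LipschitzWith 1 h) (x : ℝ) :
    HasDerivAt (steinIntegral k h) (h x * radialWeight k x) x :=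
  hasDerivAt_integral_Iic (hh.continuous.mul (continuous_radialWeight k))
    (integrable_lipschitz_mul_radialWeight k hh) x

lemma lipschitz_comp_neg {h : ℝ → ℝ} (hh : LipschitzWith 1 h) : LipschitzWith 1 fun t => h (-t) :=
  LipschitzWith.of_dist_le_mul fun x y => by
    have := abs_sub_le_of_lipschitz hh (-x) (-y)
    rw [Real.dist_eq, Real.dist_eq, NNReal.coe_one, one_mul]
    rwa [show -x - -y = -(x - y) by ring, abs_neg] at this

/-- Reflection turns the left tail into the right tail, which is its negative because `h` is
centred. This allows the estimates below to assume `x ≥ 0`. -/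
lemma steinIntegral_comp_neg (k : ℕ) {h : ℝ → ℝ} (hh : LipschitzWith 1 h)
    (hz : ∫ t, h t * radialWeight k t = 0) (x : ℝ) :
    steinIntegral k (fun t => h (-t)) (-x) = -steinIntegral k h x := by
  have h1 := integral_comp_neg_Iic (-x) fun t => h t * radialWeight k t
  simp only [radialWeight_neg, neg_neg] at h1
  have h2 := integral_Iic_add_Ioi_eq (integrable_lipschitz_mul_radialWeight k hh) x
  rw [steinIntegral, steinIntegral, h1]
  linarith

/-- Covariance-type identities for the Stein integral, together with the two one-sided bounds on
the increments of a Lipschitz function. -/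
lemma exists_steinIntegral_decomposition (k : ℕ) {h : ℝ → ℝ} (hh : LipschitzWith 1 h)
    (hz : ∫ t, h t * radialWeight k t = 0) {x : ℝ} (hx : 0 ≤ x) :
    ∃ a b : ℝ, |a| ≤ x * (2 * gaussTail k 0) + (gaussTail (k + 1) x - x * gaussTail k x) ∧
      |b| ≤ gaussTail (k + 1) x - x * gaussTail k x ∧
      2 * gaussTail k 0 * h x = a - b ∧
      2 * gaussTail k 0 * steinIntegral k h x
        = -(a * gaussTail k x + b * (2 * gaussTail k 0 - gaussTail k x)) := by
  have iw := integrable_radialWeight k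
  have it := integrable_id_mul_radialWeight k
  have ih := integrable_lipschitz_mul_radialWeight k hh
  have hQ := integral_Ioi_radialWeight k hx
  have hPQ := integral_Iic_add_Ioi_eq iw x
  rw [hQ, integral_radialWeight] at hPQ
  have hG := integral_Iic_add_Ioi_eq ih x
  rw [hz] at hG
  have hD : ∫ t in Ioi x, t * radialWeight k t = gaussTail (k + 1) x := radialTail_of_nonneg k hx
  have hD' := integral_Iic_id_mul_radialWeight k x
  rw [radialTail_of_nonneg k hx] at hD'
  have ea : ∫ t in Iic x, (h x * radialWeight k t - h t * radialWeight k t)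
      = h x * (2 * gaussTail k 0 - gaussTail k x) - steinIntegral k h x := by
    rw [integral_sub (iw.const_mul _).integrableOn ih.integrableOn, integral_const_mul]
    rw [show ∫ t in Iic x, radialWeight k t = 2 * gaussTail k 0 - gaussTail k x by linarith]
    rfl
  have eb : ∫ t in Ioi x, (h t * radialWeight k t - h x * radialWeight k t)
      = -steinIntegral k h x - h x * gaussTail k x := by
    rw [integral_sub ih.integrableOn (iw.const_mul _).integrableOn, integral_const_mul, hQ]
    rw [steinIntegral]
    linarith
  refine ⟨∫ t in Iic x, (h x * radialWeight k t - h t * radialWeight k t),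
    ∫ t in Ioi x, (h t * radialWeight k t - h x * radialWeight k t), ?_, ?_, ?_, ?_⟩
  · have e : ∫ t in Iic x, (x * radialWeight k t - t * radialWeight k t)
        = x * (2 * gaussTail k 0) + (gaussTail (k + 1) x - x * gaussTail k x) := by
      rw [integral_sub (iw.const_mul _).integrableOn it.integrableOn, integral_const_mul, hD']
      rw [show ∫ t in Iic x, radialWeight k t = 2 * gaussTail k 0 - gaussTail k x by linarith]
      ring
    -- The Lipschitz condition dominates the increment by that of the identity, whose integral is
    -- `e`.
    rw [← e, ← Real.norm_eq_abs]
    refine norm_integral_le_of_norm_le ((iw.const_mul _).sub it).integrableOn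
      ((ae_restrict_iff' measurableSet_Iic).2 (ae_of_all _ fun t ht => ?_))
    rw [← sub_mul, norm_mul, Real.norm_of_nonneg (radialWeight_nonneg k t), Real.norm_eq_abs]
    have := abs_sub_le_of_lipschitz hh x t
    rw [abs_of_nonneg (sub_nonneg.2 (mem_Iic.1 ht))] at this
    simpa [sub_mul] using mul_le_mul_of_nonneg_right this (radialWeight_nonneg k t)
  · have e : ∫ t in Ioi x, (t * radialWeight k t - x * radialWeight k t)
        = gaussTail (k + 1) x - x * gaussTail k x := by
      rw [integral_sub it.integrableOn (iw.const_mul _).integrableOn, integral_const_mul, hD, hQ]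
    rw [← e, ← Real.norm_eq_abs]
    refine norm_integral_le_of_norm_le (it.sub (iw.const_mul _)).integrableOn
      ((ae_restrict_iff' measurableSet_Ioi).2 (ae_of_all _ fun t ht => ?_))
    rw [← sub_mul, norm_mul, Real.norm_of_nonneg (radialWeight_nonneg k t), Real.norm_eq_abs]
    have := abs_sub_le_of_lipschitz hh t x
    rw [abs_of_nonneg (sub_nonneg.2 (le_of_lt (mem_Ioi.1 ht)))] at this
    simpa [sub_mul] using mul_le_mul_of_nonneg_right this (radialWeight_nonneg k t)
  · rw [ea, eb]; ring
  · rw [ea, eb]; ring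

/-- The identity is extremal: with `J = D - xQ`, the triangle inequality in the decomposition gives
`(2Zx + J)Q + J(2Z - Q) = 2Z(xQ + J) = 2ZD`. -/
lemma abs_steinIntegral_le (k : ℕ) {h : ℝ → ℝ} (hh : LipschitzWith 1 h)
    (hz : ∫ t, h t * radialWeight k t = 0) (x : ℝ) :
    |steinIntegral k h x| ≤ radialTail k x := by
  wlog hx : 0 ≤ x generalizing h x
  · have := this (lipschitz_comp_neg hh) (x := -x)
      (by rw [← hz, ← integral_neg_eq_self]; simp [radialWeight_neg]) (by linarith)
    rwa [steinIntegral_comp_neg k hh hz, abs_neg, radialTail_neg] at this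
  obtain ⟨a, b, ha, hb, -, hG⟩ := exists_steinIntegral_decomposition k hh hz hx
  rw [radialTail_of_nonneg k hx]
  have hZ := gaussTail_pos k le_rfl
  have hQ := gaussTail_pos k hx
  have hQZ := gaussTail_antitone k hx
  set Q := gaussTail k x
  set D := gaussTail (k + 1) x
  set Z := gaussTail k 0
  have h1 : |2 * Z * steinIntegral k h x| ≤ 2 * Z * D := by
    rw [hG, abs_neg]
    calc |a * Q + b * (2 * Z - Q)| ≤ |a * Q| + |b * (2 * Z - Q)| := abs_add_le _ _
      _ = |a| * Q + |b| * (2 * Z - Q) := by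
        rw [abs_mul, abs_mul, abs_of_pos hQ, abs_of_nonneg (by linarith : 0 ≤ 2 * Z - Q)]
      _ ≤ (x * (2 * Z) + (D - x * Q)) * Q + (D - x * Q) * (2 * Z - Q) := by
        gcongr
        linarith
      _ = 2 * Z * D := by ring
  rw [abs_mul, abs_of_pos (by linarith : 0 < 2 * Z)] at h1
  exact le_of_mul_le_mul_left h1 (by linarith)

/-- Put `J = D - xQ` and `I = 2Zx + J`. The decomposition gives `2Z(hD + xG) = aJ - bI`, of size at
most `2IJ`. Log-concavity gives `pJ ≤ Q²`, and `Q ≤ Z` then brings the bound to `2Z(xQ² + QD)`,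
which `mul_sq_add_mul_le_gaussTail_sq` controls. -/
lemma radialWeight_mul_abs_le {k : ℕ} (hk : 2 ≤ k) {h : ℝ → ℝ} (hh : LipschitzWith 1 h)
    (hz : ∫ t, h t * radialWeight k t = 0) (x : ℝ) :
    radialWeight k x * |h x * radialTail k x + x * steinIntegral k h x| ≤ radialTail k x ^ 2 := by
  wlog hx : 0 ≤ x generalizing h x
  · have := this (lipschitz_comp_neg hh) (x := -x)
      (by rw [← hz, ← integral_neg_eq_self]; simp [radialWeight_neg]) (by linarith)
    rw [steinIntegral_comp_neg k hh hz, radialTail_neg, radialWeight_neg] at this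
    simpa using this
  obtain ⟨a, b, ha, hb, hhx, hG⟩ := exists_steinIntegral_decomposition k hh hz hx
  rw [radialTail_of_nonneg k hx, radialWeight_of_nonneg k hx]
  obtain ⟨n, rfl⟩ := Nat.exists_eq_add_of_le' hk
  have hZ := gaussTail_pos (n + 2) le_rfl
  have hQ := gaussTail_pos (n + 2) hx
  have hQZ := gaussTail_antitone (n + 2) hx
  have hlc := pow_mul_gaussWeight_mul_le (n + 1) hx
  have hJ := mul_gaussTail_le (n + 2) hx
  have hm := mul_sq_add_mul_le_gaussTail_sq n hx
  change x ^ (n + 2) * _ * (gaussTail (n + 3) x - x * gaussTail (n + 2) x) ≤ _ at hlc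
  change _ ≤ gaussTail (n + 3) x at hJ
  have hD := gaussTail_pos (n + 3) hx
  have hp : 0 ≤ x ^ (n + 2) * gaussWeight x :=
    mul_nonneg (pow_nonneg hx _) (gaussWeight_pos x).le
  change |a| ≤ x * (2 * gaussTail (n + 2) 0) + (gaussTail (n + 3) x - _) at ha
  change |b| ≤ gaussTail (n + 3) x - _ at hb
  change _ * |h x * gaussTail (n + 3) x + _| ≤ gaussTail (n + 3) x ^ 2
  set p := x ^ (n + 2) * gaussWeight x
  set G := steinIntegral (n + 2) h x
  set Q := gaussTail (n + 2) x
  set D := gaussTail (n + 3) x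
  set Z := gaussTail (n + 2) 0
  have hJ0 : 0 ≤ D - x * Q := sub_nonneg.2 hJ
  have hI0 : 0 ≤ x * (2 * Z) + (D - x * Q) := by positivity
  have e : 2 * Z * (h x * D + x * G)
      = a * (D - x * Q) - b * (x * (2 * Z) + (D - x * Q)) := by
    calc 2 * Z * (h x * D + x * G) = (2 * Z * h x) * D + x * (2 * Z * G) := by ring
      _ = _ := by rw [hhx, hG]; ring
  have h1 : 2 * Z * |h x * D + x * G|
      ≤ 2 * (x * (2 * Z) + (D - x * Q)) * (D - x * Q) := by
    rw [← abs_of_pos (by linarith : 0 < 2 * Z), ← abs_mul, abs_of_pos (by linarith : 0 < 2 * Z), e]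
    calc _ ≤ |a * (D - x * Q)| + |b * (x * (2 * Z) + (D - x * Q))| := abs_sub _ _
      _ = |a| * (D - x * Q) + |b| * (x * (2 * Z) + (D - x * Q)) := by
        rw [abs_mul, abs_mul, abs_of_nonneg hJ0, abs_of_nonneg hI0]
      _ ≤ (x * (2 * Z) + (D - x * Q)) * (D - x * Q)
          + (D - x * Q) * (x * (2 * Z) + (D - x * Q)) := by gcongr
      _ = _ := by ring
  have h2 : 2 * Z * (p * |h x * D + x * G|) ≤ 2 * Z * D ^ 2 := by
    calc 2 * Z * (p * |h x * D + x * G|) = p * (2 * Z * |h x * D + x * G|) := by ring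
      _ ≤ p * (2 * (x * (2 * Z) + (D - x * Q)) * (D - x * Q)) :=
        mul_le_mul_of_nonneg_left h1 hp
      _ = 2 * (x * (2 * Z) + (D - x * Q)) * (p * (D - x * Q)) := by ring
      _ ≤ 2 * (x * (2 * Z) + (D - x * Q)) * Q ^ 2 :=
        mul_le_mul_of_nonneg_left hlc (by linarith)
      _ = 2 * Z * (2 * x * Q ^ 2) + 2 * (Q * (Q * (D - x * Q))) := by ring
      _ ≤ 2 * Z * (2 * x * Q ^ 2) + 2 * (Z * (Q * (D - x * Q))) := by gcongr
      _ = 2 * Z * (x * Q ^ 2 + Q * D) := by ring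
      _ ≤ 2 * Z * D ^ 2 := mul_le_mul_of_nonneg_left hm (by linarith)
  exact le_of_mul_le_mul_left h2 (by linarith)

/-! ### The Stein quotient is bounded and Lipschitz -/

/-- The quotient of the Stein integral of `h` by the Stein integral of the identity. -/
noncomputable def steinRatio (k : ℕ) (h : ℝ → ℝ) (x : ℝ) : ℝ := steinIntegral k h x / radialTail k x

lemma abs_steinRatio_le (k : ℕ) {h : ℝ → ℝ} (hh : LipschitzWith 1 h)
    (hz : ∫ t, h t * radialWeight k t = 0) (x : ℝ) : |steinRatio k h x| ≤ 1 := by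
  rw [steinRatio, abs_div, abs_of_pos (radialTail_pos k x), div_le_one (radialTail_pos k x)]
  exact abs_steinIntegral_le k hh hz x

lemma abs_steinRatio_sub_le {k : ℕ} (hk : 2 ≤ k) {h : ℝ → ℝ} (hh : LipschitzWith 1 h)
    (hz : ∫ t, h t * radialWeight k t = 0) (x y : ℝ) :
    |steinRatio k h x - steinRatio k h y| ≤ |x - y| := by
  have hd : ∀ x, HasDerivAt (steinRatio k h)
      (radialWeight k x * (h x * radialTail k x + x * steinIntegral k h x) / radialTail k x ^ 2)
      x := fun x =>
    ((hasDerivAt_steinIntegral k hh x).div (hasDerivAt_radialTail k x)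
      (radialTail_pos k x).ne').congr_deriv (by ring)
  refine abs_sub_le_of_lipschitz (lipschitzWith_of_nnnorm_deriv_le
    (fun x => (hd x).differentiableAt) fun x => ?_) x y
  rw [(hd x).deriv, ← NNReal.coe_le_coe, coe_nnnorm, NNReal.coe_one, Real.norm_eq_abs, abs_div,
    abs_mul, abs_of_nonneg (radialWeight_nonneg k x), abs_of_pos (pow_pos (radialTail_pos k x) 2),
    div_le_one (pow_pos (radialTail_pos k x) 2)]
  exact radialWeight_mul_abs_le hk hh hz x

/-! ### The coefficients `a_r(k)` -/

lemma radialCoeff_zero (k : ℕ) : radialCoeff 0 k = 1 := by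
  have : Real.Gamma ((k : ℝ) / 2 + 1) ≠ 0 := (Real.Gamma_pos_of_pos (by positivity)).ne'
  simp [radialCoeff, this]

/-- The denominator's Gamma argument is unchanged and the numerator's grows by one. The factor `k +
2` is the one in `radialRatio_add_two`, so the expansion coefficients are exactly the `a_r(k)`. -/
lemma radialCoeff_succ (r k : ℕ) :
    radialCoeff (r + 1) (k + 2) = (k + 2) * radialCoeff r k := by
  have h : Real.Gamma (((k + 2 : ℕ) : ℝ) / 2 + 1) = ((k : ℝ) / 2 + 1) * Real.Gamma ((k : ℝ) / 2 + 1) := by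
    rw [← Real.Gamma_add_one (by positivity)]
    congr 1
    push_cast
    ring
  have h2 : ((k + 2 : ℕ) : ℝ) / 2 - (r + 1 : ℕ) + 1 = (k : ℝ) / 2 - r + 1 := by
    push_cast
    ring
  rw [radialCoeff, radialCoeff, h, h2, pow_succ]
  ring

lemma radialCoeff_one_one : radialCoeff 1 1 = 1 := by
  have h : Real.Gamma ((1 : ℝ) / 2 + 1) = 1 / 2 * Real.Gamma (1 / 2) :=
    Real.Gamma_add_one (by norm_num)
  have h0 : Real.Gamma (1 / 2) ≠ 0 := (Real.Gamma_pos_of_pos (by norm_num)).ne'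
  rw [radialCoeff]
  norm_num
  norm_num at h h0
  rw [h]
  field_simp

lemma radialCoeff_pos {r k : ℕ} (h : 2 * r < k + 2) : 0 < radialCoeff r k := by
  have h' : (2 : ℝ) * r < k + 2 := by exact_mod_cast h
  exact mul_pos (div_pos (Real.Gamma_pos_of_pos (by positivity))
    (Real.Gamma_pos_of_pos (by linarith))) (by positivity)

lemma two_le_radialCoeff_even (n : ℕ) : 2 ≤ radialCoeff (n + 1) (2 * (n + 1)) := by
  induction n with
  | zero => rw [show 2 * (0 + 1) = 0 + 2 from rfl, radialCoeff_succ, radialCoeff_zero]; norm_num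
  | succ n ih =>
    rw [show 2 * (n + 1 + 1) = 2 * (n + 1) + 2 by ring, radialCoeff_succ]
    have : (0 : ℝ) ≤ (2 * (n + 1) : ℕ) := by positivity
    nlinarith

lemma one_le_radialCoeff_odd (n : ℕ) : 1 ≤ radialCoeff (n + 1) (2 * n + 1) := by
  induction n with
  | zero => rw [show 2 * 0 + 1 = 1 from rfl, radialCoeff_one_one]
  | succ n ih =>
    rw [show 2 * (n + 1) + 1 = 2 * n + 1 + 2 by ring, radialCoeff_succ]
    have : (0 : ℝ) ≤ (2 * n + 1 : ℕ) := by positivity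
    nlinarith

/-! ### The Mills ratio -/

/-- The Mills ratio of the Gaussian weight. -/
noncomputable def millsRatio (x : ℝ) : ℝ := gaussTail 0 x / gaussWeight x

lemma hasDerivAt_millsRatio (x : ℝ) : HasDerivAt millsRatio (x * millsRatio x - 1) x := by
  have he := (gaussWeight_pos x).ne'
  refine ((hasDerivAt_gaussTail 0 x).div (hasDerivAt_gaussWeight x) he).congr_deriv ?_
  rw [millsRatio]
  field_simp
  ring

lemma millsRatio_nonneg {x : ℝ} (hx : 0 ≤ x) : 0 ≤ millsRatio x :=
  div_nonneg (gaussTail_nonneg 0 hx) (gaussWeight_pos x).le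

lemma mul_millsRatio_le_one {x : ℝ} (hx : 0 ≤ x) : x * millsRatio x ≤ 1 := by
  have h := mul_gaussTail_le 0 hx
  rw [zero_add, gaussTail_one] at h
  rw [millsRatio, ← mul_div_assoc, div_le_one (gaussWeight_pos x)]
  exact h

lemma millsRatio_zero_le : millsRatio 0 ≤ 3 / 2 := by
  have h := integral_gaussian_Ioi (1 / 2)
  have h1 : gaussTail 0 0 = √(Real.pi / (1 / 2)) / 2 := by
    rw [← h, gaussTail]
    refine setIntegral_congr_fun measurableSet_Ioi fun t _ => ?_
    simp only [gaussWeight, pow_zero, one_mul]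
    congr 1
    ring
  have h2 : √(Real.pi / (1 / 2)) ≤ 3 :=
    Real.sqrt_le_iff.2 ⟨by norm_num, by linarith [Real.pi_lt_d2]⟩
  rw [millsRatio, h1]
  simp [gaussWeight] at h2 ⊢
  linarith

lemma millsRatio_le {x : ℝ} (hx : 0 ≤ x) : millsRatio x ≤ 3 / 2 := by
  have h : AntitoneOn millsRatio (Ici 0) := by
    refine antitoneOn_of_deriv_nonpos (convex_Ici 0)
      (fun x _ => (hasDerivAt_millsRatio x).continuousAt.continuousWithinAt)
      (fun x _ => (hasDerivAt_millsRatio x).differentiableAt.differentiableWithinAt) fun x hx => ?_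
    rw [interior_Ici] at hx
    rw [(hasDerivAt_millsRatio x).deriv]
    linarith [mul_millsRatio_le_one (le_of_lt hx)]
  exact (h self_mem_Ici hx hx).trans millsRatio_zero_le

/-- The derivative `x M(x) - 1` lies in `[-1, 0]` on the half-line. -/
lemma abs_millsRatio_sub_le {x y : ℝ} (hx : 0 ≤ x) (hy : 0 ≤ y) :
    |millsRatio x - millsRatio y| ≤ |x - y| := by
  have h := (convex_Ici (0 : ℝ)).norm_image_sub_le_of_norm_hasDerivWithin_le (C := 1)
    (fun x _ => (hasDerivAt_millsRatio x).hasDerivWithinAt) (fun x hx => by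
      have h1 := mul_millsRatio_le_one hx
      have h2 := mul_nonneg hx (millsRatio_nonneg hx)
      rw [Real.norm_eq_abs, abs_le]
      constructor <;> linarith) (mem_Ici.2 hy) (mem_Ici.2 hx)
  simpa using h

/-! ### Expansion of the explicit factor -/

/-- The Stein solution attached to the identity, divided by `|x| ^ k` and multiplied by `x`. -/
noncomputable def radialRatio (k : ℕ) (x : ℝ) : ℝ :=
  x * (radialTail k x / gaussWeight x) / |x| ^ k

lemma radialTail_add_two (k : ℕ) (x : ℝ) :
    radialTail (k + 2) x = |x| ^ (k + 2) * gaussWeight x + (k + 2) * radialTail k x := by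
  rw [radialTail_eq, radialTail_eq, show k + 2 + 1 = k + 1 + 2 by ring, gaussTail_add_two,
    gaussWeight_abs]
  push_cast
  ring

lemma radialTail_zero (x : ℝ) : radialTail 0 x = gaussWeight x := by
  rw [radialTail_eq, zero_add, gaussTail_one, gaussWeight_abs]

lemma radialTail_one (x : ℝ) : radialTail 1 x = |x| * gaussWeight x + gaussTail 0 |x| := by
  rw [radialTail_eq, show 1 + 1 = 0 + 2 from rfl, gaussTail_add_two, gaussWeight_abs]
  simp

lemma radialRatio_add_two (k : ℕ) {x : ℝ} (hx : x ≠ 0) :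
    radialRatio (k + 2) x = x + (k + 2) / x ^ 2 * radialRatio k x := by
  have he := (gaussWeight_pos x).ne'
  have hx' := abs_pos.2 hx
  rw [radialRatio, radialRatio, radialTail_add_two, ← sq_abs x, pow_add]
  field_simp

lemma radialRatio_even (n : ℕ) {x : ℝ} (hx : x ≠ 0) :
    radialRatio (2 * n) x
      = x + ∑ i ∈ Finset.range n, radialCoeff (i + 1) (2 * n) * (1 / x ^ (2 * i + 1)) := by
  induction n with
  | zero => simp [radialRatio, radialTail_zero, (gaussWeight_pos x).ne']
  | succ n ih =>
    rw [show 2 * (n + 1) = 2 * n + 2 by ring, radialRatio_add_two _ hx, ih, Finset.sum_range_succ',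
      mul_add, Finset.mul_sum, radialCoeff_succ, radialCoeff_zero, add_comm (_ / _ * x)]
    congr 2
    · refine Finset.sum_congr rfl fun i _ => ?_
      rw [radialCoeff_succ (i + 1)]
      field_simp
      ring
    · field_simp
      ring

/-- The recursion ends at `k = 1`, where integration by parts leaves the tail of order zero; it has
no elementary form and survives as the Mills ratio. -/
lemma radialRatio_odd (n : ℕ) {x : ℝ} (hx : x ≠ 0) :
    radialRatio (2 * n + 1) x
      = x + (∑ i ∈ Finset.range n, radialCoeff (i + 1) (2 * n + 1) * (1 / x ^ (2 * i + 1)))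
        + radialCoeff (n + 1) (2 * n + 1) * (millsRatio |x| * (x / |x| ^ (2 * n + 1))) := by
  have hx' := abs_pos.2 hx
  induction n with
  | zero =>
    have he := (gaussWeight_pos x).ne'
    simp only [radialRatio, mul_zero, zero_add, radialTail_one, radialCoeff_one_one, millsRatio,
      gaussWeight_abs, Finset.range_zero, Finset.sum_empty]
    field_simp
    ring
  | succ n ih =>
    rw [show 2 * (n + 1) + 1 = 2 * n + 1 + 2 by ring, radialRatio_add_two _ hx, ih,
      Finset.sum_range_succ', mul_add, mul_add, Finset.mul_sum, radialCoeff_succ, radialCoeff_zero,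
      add_comm (_ / _ * x), ← add_assoc, ← add_assoc]
    congr 1
    · rw [add_assoc, add_assoc]
      congr 2
      · refine Finset.sum_congr rfl fun i _ => ?_
        rw [show 2 * n + (1 + 2) = 2 * n + 1 + 2 by ring, radialCoeff_succ (i + 1)]
        field_simp
        ring
      · field_simp
        ring
    · rw [radialCoeff_succ (n + 1), ← sq_abs x, pow_add _ _ 2]
      field_simp
      ring

/-! ### The Stein solution and pointwise estimates -/

/-- The solution `f` of `f' - x f = |x| ^ k h` given by the Stein integral of `h`. -/
noncomputable def steinSolution (k : ℕ) (h : ℝ → ℝ) (x : ℝ) : ℝ := steinIntegral k h x / gaussWeight x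

lemma hasDerivAt_steinSolution (k : ℕ) {h : ℝ → ℝ} (hh : LipschitzWith 1 h) (x : ℝ) :
    HasDerivAt (steinSolution k h) (h x * |x| ^ k + x * steinSolution k h x) x := by
  have he := (gaussWeight_pos x).ne'
  refine ((hasDerivAt_steinIntegral k hh x).div (hasDerivAt_gaussWeight x) he).congr_deriv ?_
  rw [steinSolution, radialWeight]
  field_simp
  ring

lemma mul_steinSolution_div (k : ℕ) (h : ℝ → ℝ) (x : ℝ) :
    x * steinSolution k h x / |x| ^ k = radialRatio k x * steinRatio k h x := by
  have he := (gaussWeight_pos x).ne'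
  have hD := (radialTail_pos k x).ne'
  rw [steinSolution, radialRatio, steinRatio]
  field_simp

/-- Deliberately asymmetric: only `|a|` multiplies `d`. With `a` evaluated at `F`, the weights on
`|F - F⋆|` produced here involve `F` alone. -/
lemma abs_mul_sub_mul_le {a b u v d m : ℝ} (hv : |v| ≤ m) (huv : |u - v| ≤ d) :
    |a * u - b * v| ≤ m * |a - b| + |a| * d := by
  calc |a * u - b * v| = |(a - b) * v + a * (u - v)| := by congr 1; ring
    _ ≤ |(a - b) * v| + |a * (u - v)| := abs_add_le _ _
    _ = |a - b| * |v| + |a| * |u - v| := by rw [abs_mul, abs_mul]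
    _ ≤ |a - b| * m + |a| * d := by gcongr
    _ = _ := by ring

/-- Take `x > 0`, `q = |y|`, `A = x^{-2n}`, `B = q^{-2n}`. Since `B` lies between `A` and `Bx/q`,
the case `y > 0` holds without the factor 2. For `y < 0` the claim is `A + B ≤ 2(A + Bx/q)`, true
because `B` is at most `A` or at most `Bx/q`. -/
lemma abs_div_abs_pow_sub_le (n : ℕ) {x y : ℝ} (hx : x ≠ 0) (hy : y ≠ 0) :
    |x / |x| ^ (2 * n + 1) - y / |y| ^ (2 * n + 1)|
      ≤ 2 * (|x| * |1 / x ^ (2 * n + 1) - 1 / y ^ (2 * n + 1)|) := by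
  wlog hx0 : 0 < x generalizing x y
  · have h := this (neg_ne_zero.2 hx) (neg_ne_zero.2 hy)
      (by rcases hx.lt_or_gt with h | h <;> [linarith; exact absurd h hx0])
    have ho : Odd (2 * n + 1) := ⟨n, rfl⟩
    rw [abs_neg, abs_neg, ho.neg_pow, ho.neg_pow, neg_div, neg_div, div_neg, div_neg,
      neg_sub_neg, neg_sub_neg, abs_sub_comm, abs_sub_comm (1 / y ^ _)] at h
    exact h
  rw [abs_of_pos hx0]
  have e1 : x / x ^ (2 * n + 1) = 1 / x ^ (2 * n) := by field_simp; ring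
  obtain ⟨q, hq, hyq⟩ : ∃ q, 0 < q ∧ |y| = q := ⟨|y|, abs_pos.2 hy, rfl⟩
  have e2 : q / q ^ (2 * n + 1) = 1 / q ^ (2 * n) := by field_simp; ring
  have e3 : x * (1 / q ^ (2 * n + 1)) = 1 / q ^ (2 * n) * (x / q) := by field_simp; ring
  have hA : 0 < 1 / x ^ (2 * n) := by positivity
  have hB : 0 < 1 / q ^ (2 * n) := by positivity
  have hC : 0 < x / q := by positivity
  have key : (1 / q ^ (2 * n) * (x / q) ≤ 1 / q ^ (2 * n) ∧ 1 / q ^ (2 * n) ≤ 1 / x ^ (2 * n)) ∨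
      (1 / q ^ (2 * n) ≤ 1 / q ^ (2 * n) * (x / q) ∧ 1 / x ^ (2 * n) ≤ 1 / q ^ (2 * n)) := by
    rcases le_total x q with h | h
    · exact Or.inl ⟨mul_le_of_le_one_right hB.le ((div_le_one hq).2 h), by gcongr⟩
    · exact Or.inr ⟨le_mul_of_one_le_right hB.le ((one_le_div hq).2 h), by gcongr⟩
  have e4 : x * |1 / x ^ (2 * n + 1) - 1 / y ^ (2 * n + 1)|
      = |x / x ^ (2 * n + 1) - x * (1 / y ^ (2 * n + 1))| := by
    rw [← abs_of_pos hx0, ← abs_mul, abs_of_pos hx0, mul_sub]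
    congr 2
    ring
  rw [e4, e1, hyq]
  rcases abs_choice y with h | h
  · rw [h] at hyq
    rw [hyq, e2, e3]
    have h0 := abs_nonneg (1 / x ^ (2 * n) - 1 / q ^ (2 * n) * (x / q))
    suffices |1 / x ^ (2 * n) - 1 / q ^ (2 * n)| ≤ |1 / x ^ (2 * n) - 1 / q ^ (2 * n) * (x / q)| by
      linarith
    rcases key with ⟨h1, h2⟩ | ⟨h1, h2⟩
    · rw [abs_of_nonneg (by linarith), abs_of_nonneg (by linarith)]
      linarith
    · rw [abs_of_nonpos (by linarith), abs_of_nonpos (by linarith)]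
      linarith
  · have hy' : y = -q := by linarith
    have ho : Odd (2 * n + 1) := ⟨n, rfl⟩
    rw [hy', ho.neg_pow, neg_div, div_neg, mul_neg, sub_neg_eq_add, sub_neg_eq_add, e2, e3,
      abs_of_pos (by positivity), abs_of_pos (by positivity)]
    have := mul_pos hB hC
    rcases key with ⟨h1, h2⟩ | ⟨h1, h2⟩ <;> linarith

/-- The function whose expectations at `F` and at its radial bias are compared. -/
noncomputable def steinTest (k : ℕ) (h : ℝ → ℝ) (x : ℝ) : ℝ :=
  h x + radialRatio k x * steinRatio k h x

lemma abs_main_part_sub_le {k : ℕ} (hk : 2 ≤ k) {h : ℝ → ℝ} (hh : LipschitzWith 1 h)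
    (hz : ∫ t, h t * radialWeight k t = 0) (x y : ℝ) :
    |(h x + x * steinRatio k h x) - (h y + y * steinRatio k h y)| ≤ (2 + |x|) * |x - y| := by
  have h1 := abs_sub_le_of_lipschitz hh x y
  have h2 := abs_mul_sub_mul_le (a := x) (b := y) (abs_steinRatio_le k hh hz y)
    (abs_steinRatio_sub_le hk hh hz x y)
  calc _ = |(h x - h y) + (x * steinRatio k h x - y * steinRatio k h y)| := by congr 1; ring
    _ ≤ _ := abs_add_le _ _
    _ ≤ |x - y| + (1 * |x - y| + |x| * |x - y|) := add_le_add h1 h2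
    _ = _ := by ring

lemma abs_sum_part_sub_le {k : ℕ} (hk : 2 ≤ k) {h : ℝ → ℝ} (hh : LipschitzWith 1 h)
    (hz : ∫ t, h t * radialWeight k t = 0) {n : ℕ} {c : ℕ → ℝ} (hc : ∀ i < n, 0 ≤ c i) (x y : ℝ) :
    |(∑ i ∈ Finset.range n, c i * (1 / x ^ (2 * i + 1))) * steinRatio k h x
      - (∑ i ∈ Finset.range n, c i * (1 / y ^ (2 * i + 1))) * steinRatio k h y|
      ≤ ∑ i ∈ Finset.range n, c i * (|1 / x ^ (2 * i + 1) - 1 / y ^ (2 * i + 1)|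
          + 1 / |x| ^ (2 * i + 1) * |x - y|) := by
  rw [Finset.sum_mul, Finset.sum_mul, ← Finset.sum_sub_distrib]
  refine (Finset.abs_sum_le_sum_abs _ _).trans (Finset.sum_le_sum fun i hi => ?_)
  rw [mul_assoc, mul_assoc, ← mul_sub, abs_mul, abs_of_nonneg (hc i (Finset.mem_range.1 hi))]
  refine mul_le_mul_of_nonneg_left ?_ (hc i (Finset.mem_range.1 hi))
  have := abs_mul_sub_mul_le (a := 1 / x ^ (2 * i + 1)) (b := 1 / y ^ (2 * i + 1))
    (abs_steinRatio_le k hh hz y) (abs_steinRatio_sub_le hk hh hz x y)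
  rwa [one_mul, abs_div, abs_one, abs_pow] at this

lemma abs_steinTest_sub_le_even {n : ℕ} (hn : 1 ≤ n) {h : ℝ → ℝ} (hh : LipschitzWith 1 h)
    (hz : ∫ t, h t * radialWeight (2 * n) t = 0) {x y : ℝ} (hx : x ≠ 0) (hy : y ≠ 0) :
    |steinTest (2 * n) h x - steinTest (2 * n) h y| ≤ (2 + |x|) * |x - y|
      + ∑ i ∈ Finset.range n, radialCoeff (i + 1) (2 * n) *
        (|1 / x ^ (2 * i + 1) - 1 / y ^ (2 * i + 1)| + 1 / |x| ^ (2 * i + 1) * |x - y|) := by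
  have hk : 2 ≤ 2 * n := by omega
  have h1 := abs_main_part_sub_le hk hh hz x y
  have h2 := abs_sum_part_sub_le hk hh hz (n := n) (c := fun i => radialCoeff (i + 1) (2 * n))
    (fun i hi => (radialCoeff_pos (by omega)).le) x y
  rw [steinTest, steinTest, radialRatio_even n hx, radialRatio_even n hy]
  refine le_trans (le_of_eq ?_) ((abs_add_le _ _).trans (add_le_add h1 h2))
  congr 1
  ring

lemma abs_steinTest_sub_le_odd {n : ℕ} (hn : 1 ≤ n) {h : ℝ → ℝ} (hh : LipschitzWith 1 h)
    (hz : ∫ t, h t * radialWeight (2 * n + 1) t = 0) {x y : ℝ} (hx : x ≠ 0) (hy : y ≠ 0) :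
    |steinTest (2 * n + 1) h x - steinTest (2 * n + 1) h y| ≤ (2 + |x|) * |x - y|
      + (∑ i ∈ Finset.range n, radialCoeff (i + 1) (2 * n + 1) *
        (|1 / x ^ (2 * i + 1) - 1 / y ^ (2 * i + 1)| + 1 / |x| ^ (2 * i + 1) * |x - y|))
      + radialCoeff (n + 1) (2 * n + 1) * (3 * (|x| * |1 / x ^ (2 * n + 1) - 1 / y ^ (2 * n + 1)|)
        + 5 / 2 * (1 / |x| ^ (2 * n) * |x - y|)) := by
  have hk : 2 ≤ 2 * n + 1 := by omega
  have h1 := abs_main_part_sub_le hk hh hz x y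
  have h2 := abs_sum_part_sub_le hk hh hz (n := n) (c := fun i => radialCoeff (i + 1) (2 * n + 1))
    (fun i hi => (radialCoeff_pos (by omega)).le) x y
  have ha : 0 < radialCoeff (n + 1) (2 * n + 1) := radialCoeff_pos (by omega)
  have hM : |millsRatio (|y|)| ≤ 3 / 2 := by
    rw [abs_of_nonneg (millsRatio_nonneg (abs_nonneg y))]
    exact millsRatio_le (abs_nonneg y)
  have hMxy : |millsRatio (|x|) - millsRatio (|y|)| ≤ |x - y| :=
    (abs_millsRatio_sub_le (abs_nonneg x) (abs_nonneg y)).trans (abs_abs_sub_abs_le _ _)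
  have hw := abs_steinRatio_le (2 * n + 1) hh hz y
  have hW : |millsRatio |x| * steinRatio (2 * n + 1) h x
      - millsRatio |y| * steinRatio (2 * n + 1) h y| ≤ 5 / 2 * |x - y| := by
    have hMx : |millsRatio (|x|)| ≤ 3 / 2 := by
      rw [abs_of_nonneg (millsRatio_nonneg (abs_nonneg x))]
      exact millsRatio_le (abs_nonneg x)
    have := abs_mul_sub_mul_le (a := millsRatio |x|) (b := millsRatio |y|) hw
      (abs_steinRatio_sub_le hk hh hz x y)
    nlinarith [abs_nonneg (x - y), mul_le_mul_of_nonneg_right hMx (abs_nonneg (x - y))]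
  have hWy : |millsRatio |y| * steinRatio (2 * n + 1) h y| ≤ 3 / 2 := by
    rw [abs_mul]
    nlinarith [abs_nonneg (millsRatio |y|), hM]
  have hs := abs_mul_sub_mul_le (a := x / |x| ^ (2 * n + 1)) (b := y / |y| ^ (2 * n + 1)) hWy hW
  have hsx : |x / |x| ^ (2 * n + 1)| = 1 / |x| ^ (2 * n) := by
    have := abs_pos.2 hx
    rw [abs_div, abs_pow, abs_abs]
    field_simp
    ring
  have hd := abs_div_abs_pow_sub_le n hx hy
  rw [hsx] at hs
  -- `3 = 2 · 3/2` combines the factor of `abs_div_abs_pow_sub_le` with the Mills bound; `5/2 = 1 +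
  -- 3/2` is the Lipschitz constant in `hW`.
  have h3 := mul_le_mul_of_nonneg_left (hs.trans (b := _)
    (c := 3 * (|x| * |1 / x ^ (2 * n + 1) - 1 / y ^ (2 * n + 1)|)
        + 5 / 2 * (1 / |x| ^ (2 * n) * |x - y|)) (by linarith)) ha.le
  rw [← abs_of_pos ha, ← abs_mul, abs_of_pos ha] at h3
  rw [steinTest, steinTest, radialRatio_odd n hx, radialRatio_odd n hy]
  refine le_trans (le_of_eq ?_) ((abs_add_le _ _).trans
    (add_le_add ((abs_add_le _ _).trans (add_le_add h1 h2)) h3))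
  congr 1
  ring

lemma hasDerivAt_abs_pow_mul_self {k : ℕ} (hk : 2 ≤ k) (x : ℝ) :
    HasDerivAt (fun x : ℝ => |x| ^ k * x) (((k : ℝ) + 1) * |x| ^ k) x := by
  have hk' : (1 : ℝ) < k := by exact_mod_cast hk
  have h := (hasDerivAt_abs_rpow x hk').mul (hasDerivAt_id x)
  have e : ((k : ℝ) - 2) = ((k - 2 : ℕ) : ℝ) := by push_cast [hk]; ring
  simp only [e, Real.rpow_natCast] at h
  refine h.congr_deriv ?_
  have e2 : |x| ^ k = |x| ^ (k - 2) * x ^ 2 := by rw [← sq_abs x, ← pow_add]; congr 1; omega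
  rw [e2]
  simp only [id]
  ring

/-! ### Moments transferred between `F` and its radial bias -/

section Moments

variable {Ω : Type*} [MeasurableSpace Ω] {P : Measure Ω} {k : ℕ}
  {F Fs : Ω → ℝ}

lemma integral_eq_of_isRadialBias (hvar : ∫ ω, F ω ^ 2 ∂P = (k : ℝ) + 1)
    (hbias : IsRadialBias k P F Fs) {f f' : ℝ → ℝ} (hf : ∀ x, HasDerivAt f (f' x) x)
    (h1 : Integrable (fun ω => f' (Fs ω) / |Fs ω| ^ k) P)
    (h2 : Integrable (fun ω => F ω * f (F ω) / |F ω| ^ k) P) :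
    ∫ ω, f' (Fs ω) / |Fs ω| ^ k ∂P = ∫ ω, F ω * f (F ω) / |F ω| ^ k ∂P := by
  have e : deriv f = f' := funext fun x => (hf x).deriv
  have h := hbias f (fun x => (hf x).differentiableAt) (by rw [e]; exact h1) h2
  have hk : (k : ℝ) + 1 ≠ 0 := by positivity
  rwa [hvar, e, div_self hk, one_mul] at h

lemma integrable_of_integrable_of_sub {X Y : Ω → ℝ} (hX : Measurable X) (hY : Integrable Y P)
    (h : nonnegExp P (fun ω => |X ω - Y ω|) ≠ ∞) (hYm : Measurable Y) : Integrable X P := by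
  have h1 : Integrable (fun ω => X ω - Y ω) P := by
    refine ⟨(hX.sub hYm).aestronglyMeasurable, ?_⟩
    rw [hasFiniteIntegral_iff_norm]
    exact lt_top_iff_ne_top.2 h
  refine (h1.add hY).congr (ae_of_all _ fun ω => ?_)
  simp

lemma integrable_of_nonnegExp_ne_top {X : Ω → ℝ} (hX : Measurable X) (h0 : ∀ ω, 0 ≤ X ω)
    (h : nonnegExp P X ≠ ∞) : Integrable X P := by
  refine ⟨hX.aestronglyMeasurable, ?_⟩
  rw [hasFiniteIntegral_iff_ofReal (ae_of_all _ h0)]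
  exact lt_top_iff_ne_top.2 h

variable [IsProbabilityMeasure P]

/-- Test with `f(x) = |x|^k x`. As `0 / 0 = 0`, the quotient `|F⋆|^k / |F⋆|^k` is the indicator of
`F⋆ ≠ 0`, and the identity forces its expectation to be 1. -/
lemma ae_ne_zero_of_isRadialBias (hk : 2 ≤ k) (hFs : Measurable Fs)
    (hF0 : ∀ᵐ ω ∂P, F ω ≠ 0) (hF2 : Integrable (fun ω => F ω ^ 2) P)
    (hvar : ∫ ω, F ω ^ 2 ∂P = (k : ℝ) + 1) (hbias : IsRadialBias k P F Fs) :
    ∀ᵐ ω ∂P, Fs ω ≠ 0 := by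
  have hk1 : (k : ℝ) + 1 ≠ 0 := by positivity
  have hle : ∀ ω, |Fs ω| ^ k / |Fs ω| ^ k ≤ 1 := fun ω => div_self_le_one _
  have hi : Integrable (fun ω => |Fs ω| ^ k / |Fs ω| ^ k) P := by
    refine (integrable_const (1 : ℝ)).mono'
      (Measurable.aestronglyMeasurable (by fun_prop)) (ae_of_all _ fun ω => ?_)
    rw [Real.norm_of_nonneg (by positivity)]
    exact hle ω
  have eF : (fun ω => F ω * (|F ω| ^ k * F ω) / |F ω| ^ k) =ᵐ[P] fun ω => F ω ^ 2 := by
    filter_upwards [hF0] with ω hω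
    have := abs_pos.2 hω
    field_simp
  have h := integral_eq_of_isRadialBias hvar hbias (hasDerivAt_abs_pow_mul_self hk)
    (by simpa only [mul_div_assoc] using hi.const_mul ((k : ℝ) + 1)) (hF2.congr eF.symm)
  rw [integral_congr_ae eF, hvar] at h
  simp only [mul_div_assoc] at h
  rw [integral_const_mul] at h
  have h1 : ∫ ω, |Fs ω| ^ k / |Fs ω| ^ k ∂P = 1 := mul_left_cancel₀ hk1 (by linarith)
  have h2 : ∫ ω, (1 - |Fs ω| ^ k / |Fs ω| ^ k) ∂P = 0 := by
    rw [integral_sub (integrable_const _) hi, h1]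
    simp
  rw [integral_eq_zero_iff_of_nonneg (fun ω => sub_nonneg.2 (hle ω))
    ((integrable_const _).sub hi)] at h2
  filter_upwards [h2] with ω hω h0
  have hk0 : k ≠ 0 := by omega
  simp [h0, zero_pow hk0] at hω

/-- Finiteness of negative moments passes from `F` to its radial bias, with a gain of two in the
exponent. -/
lemma integrable_inv_pow_of_isRadialBias {m : ℕ} (hm1 : 1 ≤ m) (hmk : m ≤ k) (hF : Measurable F)
    (hFs : Measurable Fs) (hvar : ∫ ω, F ω ^ 2 ∂P = (k : ℝ) + 1) (hbias : IsRadialBias k P F Fs)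
    (hi : Integrable (fun ω => F ω ^ 2 / |F ω| ^ m) P) :
    Integrable (fun ω => 1 / |Fs ω| ^ m) P := by
  have hm0 : m ≠ 0 := by omega
  have hk0 : k ≠ 0 := by omega
  -- The ideal test derivative is `|t|^{k-m}`. Truncating at `n|t|^k` makes `g n / |·|^k` at most
  -- `n`, so the bias identity applies; monotone convergence removes the truncation.
  let g : ℕ → ℝ → ℝ := fun n t => min (n * |t| ^ k) (|t| ^ (k - m))
  have hgc : ∀ n, Continuous (g n) := fun n => by fun_prop
  have hg0 : ∀ n t, 0 ≤ g n t := fun n t => by positivity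
  let f : ℕ → ℝ → ℝ := fun n x => ∫ t in (0 : ℝ)..x, g n t
  have hf : ∀ n x, HasDerivAt (f n) (g n x) x := fun n x =>
    intervalIntegral.integral_hasDerivAt_right ((hgc n).intervalIntegrable _ _)
      ((hgc n).stronglyMeasurableAtFilter _ _) (hgc n).continuousAt
  have hfm : ∀ n, Measurable (f n) := fun n =>
    (Differentiable.continuous fun x => (hf n x).differentiableAt).measurable
  have hfb : ∀ n x, |f n x| ≤ |x| ^ (k - m) * |x| := fun n x => by
    have := intervalIntegral.norm_integral_le_of_norm_le_const (a := 0) (b := x) (f := g n)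
      (C := |x| ^ (k - m)) fun t ht => by
        have htx : |t| ≤ |x| := by
          rcases le_total 0 x with h | h
          · rw [uIoc_of_le h] at ht
            rw [abs_of_pos ht.1, abs_of_nonneg h]
            exact ht.2
          · rw [uIoc_of_ge h] at ht
            rw [abs_of_nonpos ht.2, abs_of_nonpos h]
            linarith [ht.1]
        rw [Real.norm_of_nonneg (hg0 n t)]
        exact (min_le_right _ _).trans (pow_le_pow_left₀ (abs_nonneg t) htx _)
    simpa using this
  have hgn : ∀ (n : ℕ) y, g n y / |y| ^ k ≤ n := fun n y => by
    rcases eq_or_ne y 0 with rfl | hy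
    · simp [hk0]
    · rw [div_le_iff₀ (pow_pos (abs_pos.2 hy) k)]
      exact min_le_left _ _
  have hI1 : ∀ n, Integrable (fun ω => g n (Fs ω) / |Fs ω| ^ k) P := fun n => by
    refine (integrable_const (n : ℝ)).mono'
      (((hgc n).measurable.comp hFs).div (by fun_prop)).aestronglyMeasurable
      (ae_of_all _ fun ω => ?_)
    rw [Real.norm_of_nonneg (div_nonneg (hg0 _ _) (by positivity))]
    exact hgn n (Fs ω)
  have hFb : ∀ n ω, ‖F ω * f n (F ω) / |F ω| ^ k‖ ≤ F ω ^ 2 / |F ω| ^ m := fun n ω => by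
    rcases eq_or_ne (F ω) 0 with h0 | h0
    · simp [h0]
    · have hp := abs_pos.2 h0
      rw [norm_div, norm_mul, Real.norm_eq_abs, Real.norm_eq_abs, norm_pow, Real.norm_eq_abs,
        abs_abs, div_le_div_iff₀ (by positivity) (by positivity)]
      calc |F ω| * |f n (F ω)| * |F ω| ^ m
          ≤ |F ω| * (|F ω| ^ (k - m) * |F ω|) * |F ω| ^ m := by gcongr; exact hfb n _
        _ = |F ω| ^ 2 * |F ω| ^ k := by
          rw [← Nat.sub_add_cancel hmk, pow_add, Nat.sub_add_cancel hmk]; ring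
        _ = _ := by rw [sq_abs]
  have hI2 : ∀ n, Integrable (fun ω => F ω * f n (F ω) / |F ω| ^ k) P := fun n =>
    hi.mono' ((hF.mul ((hfm n).comp hF)).div (by fun_prop)).aestronglyMeasurable
      (ae_of_all _ (hFb n))
  have hle : ∀ n, ∫⁻ ω, ENNReal.ofReal (g n (Fs ω) / |Fs ω| ^ k) ∂P
      ≤ ENNReal.ofReal (∫ ω, F ω ^ 2 / |F ω| ^ m ∂P) := fun n => by
    rw [← ofReal_integral_eq_lintegral_ofReal (hI1 n)
      (ae_of_all _ fun ω => div_nonneg (hg0 _ _) (by positivity))]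
    refine ENNReal.ofReal_le_ofReal ?_
    rw [integral_eq_of_isRadialBias hvar hbias (hf n) (hI1 n) (hI2 n)]
    exact integral_mono (hI2 n) hi fun ω => (le_abs_self _).trans (hFb n ω)
  refine integrable_of_nonnegExp_ne_top (by fun_prop) (fun ω => by positivity) ?_
  refine ne_top_of_le_ne_top (b := ENNReal.ofReal (∫ ω, F ω ^ 2 / |F ω| ^ m ∂P))
    ENNReal.ofReal_ne_top ?_
  refine le_of_tendsto' (lintegral_tendsto_of_tendsto_of_monotone
    (f := fun n ω => ENNReal.ofReal (g n (Fs ω) / |Fs ω| ^ k)) (fun n => ?_)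
    (ae_of_all _ fun ω => ?_) (ae_of_all _ fun ω => ?_)) hle
  · exact (((hgc n).measurable.comp hFs).div (by fun_prop)).ennreal_ofReal.aemeasurable
  · intro a b hab
    refine ENNReal.ofReal_le_ofReal ?_
    have : (a : ℝ) ≤ b := by exact_mod_cast hab
    simp only [g]
    gcongr
  · refine (ENNReal.continuous_ofReal.tendsto _).comp ?_
    rcases eq_or_ne (Fs ω) 0 with h0 | h0
    · simp [h0, hk0, hm0]
    · have hp := abs_pos.2 h0
      refine tendsto_const_nhds.congr' ?_
      obtain ⟨N, hN⟩ := exists_nat_ge (1 / |Fs ω| ^ m)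
      filter_upwards [eventually_ge_atTop N] with n hn
      have e : |Fs ω| ^ k = |Fs ω| ^ (k - m) * |Fs ω| ^ m := by
        rw [← pow_add, Nat.sub_add_cancel hmk]
      have hNn : 1 / |Fs ω| ^ m ≤ n := hN.trans (by exact_mod_cast hn)
      rw [div_le_iff₀ (by positivity)] at hNn
      have : g n (Fs ω) = |Fs ω| ^ (k - m) := by
        refine min_eq_right ?_
        rw [e]
        have := mul_le_mul_of_nonneg_left hNn (pow_pos hp (k - m)).le
        linarith
      rw [this, e]
      field_simp

/-- Bootstrap from `E|F| < ∞`: order `2i - 1` for `F` gives order `2i + 1` for `F⋆`, and the finite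
difference term of that order returns it to `F`. -/
lemma integrable_inv_odd_pow (hF : Measurable F) (hFs : Measurable Fs)
    (hF0 : ∀ᵐ ω ∂P, F ω ≠ 0) (hF1 : Integrable F P)
    (hvar : ∫ ω, F ω ^ 2 ∂P = (k : ℝ) + 1) (hbias : IsRadialBias k P F Fs) (n : ℕ)
    (hn : 2 * n + 1 ≤ k)
    (h : ∀ i ≤ n, nonnegExp P (fun ω => |1 / F ω ^ (2 * i + 1) - 1 / Fs ω ^ (2 * i + 1)|) ≠ ∞) :
    Integrable (fun ω => 1 / |Fs ω| ^ (2 * n + 1)) P ∧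
      Integrable (fun ω => 1 / |F ω| ^ (2 * n + 1)) P := by
  have abs_iff : ∀ G : Ω → ℝ, Measurable G → ∀ m : ℕ, Integrable (fun ω => 1 / |G ω| ^ m) P ↔
      Integrable (fun ω => 1 / G ω ^ m) P := fun G hG m => by
    rw [← integrable_norm_iff (f := fun ω => 1 / G ω ^ m)
      (Measurable.aestronglyMeasurable (by fun_prop))]
    simp
  suffices hs : Integrable (fun ω => F ω ^ 2 / |F ω| ^ (2 * n + 1)) P by
    have h1 := integrable_inv_pow_of_isRadialBias (by omega) hn hF hFs hvar hbias hs
    refine ⟨h1, ?_⟩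
    rw [abs_iff F hF]
    exact integrable_of_integrable_of_sub (by fun_prop) ((abs_iff Fs hFs _).1 h1) (h n le_rfl)
      (by fun_prop)
  induction n with
  | zero =>
    refine hF1.norm.congr (ae_of_all _ fun ω => ?_)
    rcases eq_or_ne (F ω) 0 with h0 | h0
    · simp [h0]
    · have := abs_pos.2 h0
      simp only [Real.norm_eq_abs]
      rw [← sq_abs]
      field_simp
      ring
  | succ n ih =>
    have hs := ih (by omega) fun i hi => h i (by omega)
    have h1 := integrable_inv_pow_of_isRadialBias (by omega) (by omega) hF hFs hvar hbias hs
    have h2 : Integrable (fun ω => 1 / F ω ^ (2 * n + 1)) P :=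
      integrable_of_integrable_of_sub (by fun_prop) ((abs_iff Fs hFs _).1 h1) (h n (by omega))
        (by fun_prop)
    rw [← abs_iff F hF] at h2
    refine h2.congr ?_
    filter_upwards [hF0] with ω h0
    have := abs_pos.2 h0
    rw [← sq_abs]
    field_simp
    ring

/-- The odd bootstrap reaches order `2n - 1` for `F`, which dominates order `2n - 2`; the gain of
two gives order `2n` for `F⋆`. The return to `F` uses `abs_div_abs_pow_sub_le` with `h'`. -/
lemma integrable_inv_even_pow {n : ℕ} (hn : 1 ≤ n) (hk : 2 * n + 1 = k) (hF : Measurable F)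
    (hFs : Measurable Fs) (hF0 : ∀ᵐ ω ∂P, F ω ≠ 0) (hFs0 : ∀ᵐ ω ∂P, Fs ω ≠ 0)
    (hF1 : Integrable F P)
    (hvar : ∫ ω, F ω ^ 2 ∂P = (k : ℝ) + 1) (hbias : IsRadialBias k P F Fs)
    (h : ∀ i < n, nonnegExp P (fun ω => |1 / F ω ^ (2 * i + 1) - 1 / Fs ω ^ (2 * i + 1)|) ≠ ∞)
    (h' : nonnegExp P (fun ω => |F ω| * |1 / F ω ^ (2 * n + 1) - 1 / Fs ω ^ (2 * n + 1)|) ≠ ∞) :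
    Integrable (fun ω => 1 / |Fs ω| ^ (2 * n)) P ∧ Integrable (fun ω => 1 / |F ω| ^ (2 * n)) P := by
  obtain ⟨m, rfl⟩ : ∃ m, n = m + 1 := ⟨n - 1, by omega⟩
  have hodd := (integrable_inv_odd_pow hF hFs hF0 hF1 hvar hbias m (by omega)
    fun i hi => h i (by omega)).2
  have hs : Integrable (fun ω => F ω ^ 2 / |F ω| ^ (2 * (m + 1))) P := by
    refine ((integrable_const (1 : ℝ)).add hodd).mono'
      (Measurable.aestronglyMeasurable (by fun_prop)) ?_
    filter_upwards [hF0] with ω h0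
    have hp := abs_pos.2 h0
    rw [Real.norm_of_nonneg (by positivity), ← sq_abs]
    simp only [Pi.add_apply]
    have e : |F ω| ^ 2 / |F ω| ^ (2 * (m + 1)) = 1 / |F ω| ^ (2 * m) := by field_simp; ring
    rw [e]
    rcases le_total 1 |F ω| with h1 | h1
    · have : 1 / |F ω| ^ (2 * m) ≤ 1 := by
        rw [div_le_one (by positivity)]
        exact one_le_pow₀ h1
      have : 0 ≤ 1 / |F ω| ^ (2 * m + 1) := by positivity
      linarith
    · have : 1 / |F ω| ^ (2 * m) ≤ 1 / |F ω| ^ (2 * m + 1) :=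
        one_div_le_one_div_of_le (by positivity) (pow_le_pow_of_le_one hp.le h1 (by omega))
      linarith
  have h1 := integrable_inv_pow_of_isRadialBias (by omega) (by omega) hF hFs hvar hbias hs
  refine ⟨h1, ?_⟩
  have h2 := integrable_of_nonnegExp_ne_top (by fun_prop) (fun ω => by positivity) h'
  refine (h1.add (h2.const_mul 2)).mono' (Measurable.aestronglyMeasurable (by fun_prop)) ?_
  filter_upwards [hF0, hFs0] with ω hx hy
  have hd := abs_div_abs_pow_sub_le (m + 1) hx hy
  have e : ∀ z : ℝ, z ≠ 0 → |z / |z| ^ (2 * (m + 1) + 1)| = 1 / |z| ^ (2 * (m + 1)) := by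
    intro z hz
    have := abs_pos.2 hz
    rw [abs_div, abs_pow, abs_abs]
    field_simp
    ring
  have ht := abs_sub_abs_le_abs_sub (F ω / |F ω| ^ (2 * (m + 1) + 1))
    (Fs ω / |Fs ω| ^ (2 * (m + 1) + 1))
  rw [e _ hx, e _ hy] at ht
  rw [Real.norm_of_nonneg (by positivity)]
  simp only [Pi.add_apply]
  linarith

end Moments

/-! ### Growth of the explicit factor and centring under the limit law -/

/-- The recursion raises the order of the singularity at 0 by two. Thus a first moment and a
negative moment of order one below the radial exponent make the Stein terms integrable. -/
lemma exists_abs_radialRatio_le (k : ℕ) :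
    ∃ C : ℝ, 0 ≤ C ∧ ∀ x : ℝ, x ≠ 0 → |radialRatio (k + 1) x| ≤ C * (|x| + 1 / |x| ^ k) := by
  induction k using Nat.twoStepInduction with
  | zero =>
    refine ⟨3 / 2, by norm_num, fun x hx => ?_⟩
    have hp := abs_pos.2 hx
    have hM : |millsRatio (|x|)| ≤ 3 / 2 := by
      rw [abs_of_nonneg (millsRatio_nonneg hp.le)]
      exact millsRatio_le hp.le
    have h := radialRatio_odd 0 hx
    rw [mul_zero, zero_add] at h
    rw [zero_add, h, radialCoeff_one_one, Finset.sum_range_zero, add_zero, one_mul]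
    refine (abs_add_le _ _).trans ?_
    rw [abs_mul, abs_div, abs_pow, abs_abs, pow_one, div_self hp.ne', pow_zero]
    linarith
  | one =>
    refine ⟨2, by norm_num, fun x hx => ?_⟩
    have hp := abs_pos.2 hx
    have h := radialRatio_add_two 0 hx
    have h0 : radialRatio 0 x = x := by
      have := radialRatio_even 0 hx
      simpa using this
    rw [zero_add, h0] at h
    rw [h]
    refine (abs_add_le _ _).trans ?_
    have e : |((0 : ℕ) + 2 : ℝ) / x ^ 2 * x| = 2 * (1 / |x| ^ 1) := by
      rw [abs_mul, abs_div, abs_pow]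
      norm_num
      field_simp
      exact sq_abs x
    rw [e]
    linarith
  | more k ih _ =>
    obtain ⟨C, hC, h⟩ := ih
    refine ⟨1 + 2 * ((k + 3) * C), by positivity, fun x hx => ?_⟩
    have hp := abs_pos.2 hx
    rw [show k + 2 + 1 = k + 1 + 2 by ring, radialRatio_add_two _ hx]
    have h1 : 1 / |x| ≤ |x| + 1 / |x| ^ (k + 2) := by
      rcases le_total 1 |x| with h1 | h1
      · have : 1 / |x| ≤ 1 := (div_le_one hp).2 h1
        have : 0 ≤ 1 / |x| ^ (k + 2) := by positivity
        linarith
      · have : 1 / |x| ≤ 1 / |x| ^ (k + 2) :=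
          one_div_le_one_div_of_le (by positivity) (pow_le_of_le_one hp.le h1 (by omega))
        linarith
    calc |x + ((k + 1 : ℕ) + 2) / x ^ 2 * radialRatio (k + 1) x|
        ≤ |x| + |((k + 1 : ℕ) + 2) / x ^ 2 * radialRatio (k + 1) x| := abs_add_le _ _
      _ = |x| + (k + 3) / |x| ^ 2 * |radialRatio (k + 1) x| := by
        rw [abs_mul, abs_div, abs_pow, abs_of_nonneg (by positivity : (0 : ℝ) ≤ (k + 1 : ℕ) + 2)]
        push_cast
        ring
      _ ≤ |x| + (k + 3) / |x| ^ 2 * (C * (|x| + 1 / |x| ^ k)) := by gcongr; exact h x hx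
      _ = |x| + (k + 3) * C * (1 / |x| + 1 / |x| ^ (k + 2)) := by
        have : 1 / |x| ^ (k + 2) = 1 / |x| ^ k / |x| ^ 2 := by rw [pow_add, div_div]
        rw [this]
        field_simp
      _ ≤ |x| + (k + 3) * C * (2 * (|x| + 1 / |x| ^ (k + 2))) := by
        gcongr
        linarith
      _ ≤ _ := by
        have : 0 ≤ 1 / |x| ^ (k + 2) := by positivity
        linarith

lemma steinTest_eq (k : ℕ) (h : ℝ → ℝ) {x : ℝ} (hx : x ≠ 0) :
    steinTest k h x = (h x * |x| ^ k + x * steinSolution k h x) / |x| ^ k := by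
  have := abs_pos.2 hx
  rw [steinTest, ← mul_steinSolution_div]
  field_simp

lemma integral_radialMeasure (k : ℕ) (h : ℝ → ℝ) :
    ∫ x, h x ∂(radialMeasure k)
      = (∫ x, h x * radialWeight k x) / ∫ x, radialWeight k x := by
  have hg : ∀ x, |x| ^ k * gaussianPDFReal 0 1 x = (√(2 * Real.pi))⁻¹ * radialWeight k x := by
    intro x
    simp [gaussianPDFReal, radialWeight, gaussWeight]
    ring
  have hs : (√(2 * Real.pi))⁻¹ ≠ 0 := by positivity
  have hd : ∀ x, radialDensity k x = radialWeight k x / ∫ x, radialWeight k x := by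
    intro x
    rw [radialDensity, radialConst]
    simp only [hg]
    rw [integral_const_mul, mul_div_mul_left _ _ hs]
  have hm : Measurable (radialDensity k) := by
    rw [show radialDensity k = fun x => radialWeight k x / ∫ x, radialWeight k x from funext hd]
    exact (continuous_radialWeight k).measurable.div_const _
  rw [radialMeasure, integral_withDensity_eq_integral_toReal_smul hm.ennreal_ofReal
    (ae_of_all _ fun x => ENNReal.ofReal_lt_top), ← integral_div]
  refine integral_congr_ae (ae_of_all _ fun x => ?_)
  have h0 : 0 ≤ radialDensity k x := by
    rw [hd]
    exact div_nonneg (radialWeight_nonneg k x) (integral_nonneg (radialWeight_nonneg k))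
  simp only [smul_eq_mul]
  rw [ENNReal.toReal_ofReal h0, hd]
  ring

lemma integral_centered_mul_radialWeight (k : ℕ) {h : ℝ → ℝ} (hh : LipschitzWith 1 h) :
    ∫ t, (h t - ∫ x, h x ∂(radialMeasure k)) * radialWeight k t = 0 := by
  have hZ : ∫ x, radialWeight k x ≠ 0 := by
    rw [integral_radialWeight]
    have := gaussTail_pos k le_rfl
    positivity
  simp only [sub_mul]
  rw [integral_sub (integrable_lipschitz_mul_radialWeight k hh)
    ((integrable_radialWeight k).const_mul _), integral_const_mul, integral_radialMeasure]
  field_simp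
  ring

/-! ### Comparison through the bias identity -/

section Comparison

variable {Ω : Type*} [MeasurableSpace Ω] {P : Measure Ω} {k : ℕ}
  {F Fs : Ω → ℝ}

lemma integrable_mul_steinSolution_div {h : ℝ → ℝ} (hh : LipschitzWith 1 h)
    (hz : ∫ t, h t * radialWeight (k + 1) t = 0) {G : Ω → ℝ} (hG : Measurable G)
    (hG0 : ∀ᵐ ω ∂P, G ω ≠ 0) (hi : Integrable G P)
    (hi' : Integrable (fun ω => 1 / |G ω| ^ k) P) :
    Integrable (fun ω => G ω * steinSolution (k + 1) h (G ω) / |G ω| ^ (k + 1)) P := by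
  obtain ⟨C, hC, hb⟩ := exists_abs_radialRatio_le k
  have hm : Measurable (steinSolution (k + 1) h) :=
    (Differentiable.continuous fun x => (hasDerivAt_steinSolution (k + 1) hh x).differentiableAt).measurable
  refine ((hi.norm.add hi').const_mul C).mono'
    ((hG.mul (hm.comp hG)).div (by fun_prop)).aestronglyMeasurable ?_
  filter_upwards [hG0] with ω h0
  rw [mul_steinSolution_div, norm_mul]
  calc _ ≤ ‖radialRatio (k + 1) (G ω)‖ * 1 :=
        mul_le_mul_of_nonneg_left (abs_steinRatio_le (k + 1) hh hz _) (norm_nonneg _)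
    _ ≤ _ := by rw [mul_one]; exact hb _ h0

variable [IsProbabilityMeasure P]

lemma integrable_lipschitz_comp {h : ℝ → ℝ} (hh : LipschitzWith 1 h) {G : Ω → ℝ}
    (hG : Measurable G) (hi : Integrable G P) : Integrable (fun ω => h (G ω)) P := by
  refine ((integrable_const |h 0|).add hi.norm).mono'
    (hh.continuous.measurable.comp hG).aestronglyMeasurable (ae_of_all _ fun ω => ?_)
  have := abs_sub_le_of_lipschitz hh (G ω) 0
  have h2 := abs_sub_abs_le_abs_sub (h (G ω)) (h 0)
  rw [sub_zero] at this
  simp only [Pi.add_apply, Real.norm_eq_abs]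
  linarith

/-- Here `k + 1` is the radial exponent. The bias identity equates `E T(F⋆)` with `E[F
f(F)/|F|^{k+1}]`, and subtracting the latter from `E T(F)` leaves `E h(F)`. -/
lemma ofReal_abs_integral_le_of_isRadialBias {h : ℝ → ℝ} (hh : LipschitzWith 1 h)
    (hz : ∫ t, h t * radialWeight (k + 1) t = 0) (hF : Measurable F) (hFs : Measurable Fs)
    (hF0 : ∀ᵐ ω ∂P, F ω ≠ 0) (hFs0 : ∀ᵐ ω ∂P, Fs ω ≠ 0) (hF1 : Integrable F P)
    (hFs1 : Integrable Fs P) (hFi : Integrable (fun ω => 1 / |F ω| ^ k) P)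
    (hFsi : Integrable (fun ω => 1 / |Fs ω| ^ k) P)
    (hvar : ∫ ω, F ω ^ 2 ∂P = ((k + 1 : ℕ) : ℝ) + 1) (hbias : IsRadialBias (k + 1) P F Fs) :
    ENNReal.ofReal |∫ ω, h (F ω) ∂P|
      ≤ nonnegExp P fun ω => |steinTest (k + 1) h (F ω) - steinTest (k + 1) h (Fs ω)| := by
  have key : ∀ G : Ω → ℝ, Measurable G → (∀ᵐ ω ∂P, G ω ≠ 0) → Integrable G P →
      Integrable (fun ω => 1 / |G ω| ^ k) P →
      Integrable (fun ω => steinTest (k + 1) h (G ω)) P := fun G hG h0 h1 h2 => by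
    refine ((integrable_lipschitz_comp hh hG h1).add
      (integrable_mul_steinSolution_div hh hz hG h0 h1 h2)).congr (ae_of_all _ fun ω => ?_)
    simp [steinTest, ← mul_steinSolution_div]
  have eFs : (fun ω => steinTest (k + 1) h (Fs ω)) =ᵐ[P] fun ω =>
      (h (Fs ω) * |Fs ω| ^ (k + 1) + Fs ω * steinSolution (k + 1) h (Fs ω)) / |Fs ω| ^ (k + 1) := by
    filter_upwards [hFs0] with ω h0
    exact steinTest_eq _ _ h0
  have iF := key F hF hF0 hF1 hFi
  have iFs := key Fs hFs hFs0 hFs1 hFsi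
  have hb := integral_eq_of_isRadialBias hvar hbias
    (f' := fun x => h x * |x| ^ (k + 1) + x * steinSolution (k + 1) h x)
    (hasDerivAt_steinSolution (k + 1) hh) (iFs.congr eFs)
    (integrable_mul_steinSolution_div hh hz hF hF0 hF1 hFi)
  rw [← integral_congr_ae eFs] at hb
  have e : ∫ ω, h (F ω) ∂P
      = ∫ ω, (steinTest (k + 1) h (F ω) - steinTest (k + 1) h (Fs ω)) ∂P := by
    rw [integral_sub iF iFs, hb,
      ← integral_sub iF (integrable_mul_steinSolution_div hh hz hF hF0 hF1 hFi)]
    refine integral_congr_ae (ae_of_all _ fun ω => ?_)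
    simp [steinTest, ← mul_steinSolution_div]
  rw [e, ← Real.enorm_eq_ofReal_abs]
  refine (enorm_integral_le_lintegral_enorm _).trans (le_of_eq ?_)
  simp only [nonnegExp, Real.enorm_eq_ofReal_abs]

lemma wassersteinDist_le_of_isRadialBias {B : Ω → ℝ} (hF : Measurable F) (hFs : Measurable Fs)
    (hF0 : ∀ᵐ ω ∂P, F ω ≠ 0) (hFs0 : ∀ᵐ ω ∂P, Fs ω ≠ 0) (hF1 : Integrable F P)
    (hFs1 : Integrable Fs P) (hFi : Integrable (fun ω => 1 / |F ω| ^ k) P)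
    (hFsi : Integrable (fun ω => 1 / |Fs ω| ^ k) P)
    (hvar : ∫ ω, F ω ^ 2 ∂P = ((k + 1 : ℕ) : ℝ) + 1) (hbias : IsRadialBias (k + 1) P F Fs)
    (hB : ∀ h : ℝ → ℝ, LipschitzWith 1 h → ∫ t, h t * radialWeight (k + 1) t = 0 →
      ∀ ω, F ω ≠ 0 → Fs ω ≠ 0 →
        |steinTest (k + 1) h (F ω) - steinTest (k + 1) h (Fs ω)| ≤ B ω) :
    wassersteinDist (P.map F) (radialMeasure (k + 1)) ≤ nonnegExp P B := by
  refine iSup₂_le fun h hh => ?_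
  set c := ∫ x, h x ∂(radialMeasure (k + 1)) with hc
  have hh' : LipschitzWith 1 fun t => h t - c :=
    LipschitzWith.of_dist_le_mul fun x y => by
      rw [Real.dist_eq, sub_sub_sub_cancel_right, Real.dist_eq, NNReal.coe_one, one_mul]
      exact abs_sub_le_of_lipschitz hh x y
  have hz := integral_centered_mul_radialWeight (k + 1) hh
  rw [← hc] at hz
  have e : (∫ x, h x ∂(P.map F)) - c = ∫ ω, (h (F ω) - c) ∂P := by
    rw [integral_map hF.aemeasurable hh.continuous.aestronglyMeasurable,
      integral_sub (integrable_lipschitz_comp hh hF hF1) (integrable_const _)]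
    simp
  rw [e]
  refine (ofReal_abs_integral_le_of_isRadialBias hh' hz hF hFs hF0 hFs0 hF1 hFs1 hFi hFsi hvar
    hbias).trans (lintegral_mono_ae ?_)
  filter_upwards [hF0, hFs0] with ω h1 h2
  exact ENNReal.ofReal_le_ofReal (hB _ hh' hz ω h1 h2)

end Comparison

/-! ### Extended expectations and fitting the pointwise bounds to the stated sums -/

section NonnegExp

variable {Ω : Type*} [MeasurableSpace Ω] {P : Measure Ω} {X Y : Ω → ℝ}

lemma nonnegExp_add_le (hX : Measurable X) :
    nonnegExp P (fun ω => X ω + Y ω) ≤ nonnegExp P X + nonnegExp P Y := by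
  rw [nonnegExp, nonnegExp, nonnegExp, ← lintegral_add_left hX.ennreal_ofReal]
  exact lintegral_mono fun ω => ENNReal.ofReal_add_le

lemma nonnegExp_const_mul {c : ℝ} (hc : 0 ≤ c) (hX : Measurable X) :
    nonnegExp P (fun ω => c * X ω) = ENNReal.ofReal c * nonnegExp P X := by
  rw [nonnegExp, nonnegExp, ← lintegral_const_mul _ hX.ennreal_ofReal]
  simp only [ENNReal.ofReal_mul hc]

lemma nonnegExp_sum_le {ι : Type*} (s : Finset ι) {X : ι → Ω → ℝ} (hX : ∀ i, Measurable (X i)) :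
    nonnegExp P (fun ω => ∑ i ∈ s, X i ω) ≤ ∑ i ∈ s, nonnegExp P (X i) := by
  classical
  induction s using Finset.induction_on with
  | empty => simp [nonnegExp]
  | insert i s hi ih =>
    simp only [Finset.sum_insert hi]
    exact (nonnegExp_add_le (hX i)).trans (add_le_add le_rfl ih)

lemma nonnegExp_mono (h : ∀ ω, X ω ≤ Y ω) : nonnegExp P X ≤ nonnegExp P Y :=
  lintegral_mono fun ω => ENNReal.ofReal_le_ofReal (h ω)

end NonnegExp

lemma sum_Icc_one_eq_sum_range {M : Type*} [AddCommMonoid M] (n : ℕ) (g : ℕ → M) :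
    ∑ j ∈ Finset.Icc 1 n, g j = ∑ i ∈ Finset.range n, g (i + 1) := by
  induction n with
  | zero => simp
  | succ n ih => rw [Finset.sum_Icc_succ_top (by omega), ih, Finset.sum_range_succ]

lemma two_add_abs_le_even {n : ℕ} (hn : 1 ≤ n) (x y : ℝ) :
    (2 + |x|) * |x - y| ≤ ∑ j ∈ Finset.Icc 0 n, radialCoeff (n - j) (2 * n) *
      (|x ^ (2 * j) - y ^ (2 * j)| + 2 * (|x| ^ (2 * j) * |x - y|)) := by
  have h0 : ∀ j, 0 ≤ radialCoeff (n - j) (2 * n) := fun j => (radialCoeff_pos (by omega)).le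
  -- Two terms suffice: `j = 0` has coefficient at least 2 and gives `4|x-y|`, while `j = n` gives
  -- `2|x|^{2n}|x-y|`; and `2 + |x| ≤ 3 + |x|^{2n}`.
  refine le_trans ?_ (Finset.sum_le_sum_of_subset_of_nonneg (s := {0, n}) ?_ fun j _ _ =>
    mul_nonneg (h0 j) (by positivity))
  · rw [Finset.sum_pair (by omega)]
    obtain ⟨m, rfl⟩ : ∃ m, n = m + 1 := ⟨n - 1, by omega⟩
    have h2 := two_le_radialCoeff_even m
    simp only [Nat.sub_zero, Nat.sub_self, radialCoeff_zero, mul_zero, pow_zero, sub_self, abs_zero,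
      one_mul, zero_add]
    have hx : |x| ≤ 1 + |x| ^ (2 * (m + 1)) := by
      rcases le_total 1 |x| with h | h
      · linarith [le_self_pow₀ h (show 2 * (m + 1) ≠ 0 by omega)]
      · have : 0 ≤ |x| ^ (2 * (m + 1)) := by positivity
        linarith
    have hd := abs_nonneg (x - y)
    have h3 := mul_le_mul_of_nonneg_right h2 hd
    have h4 := mul_le_mul_of_nonneg_right hx hd
    have h5 := abs_nonneg (x ^ (2 * (m + 1)) - y ^ (2 * (m + 1)))
    have h6 : 0 ≤ |x| ^ (2 * (m + 1)) * |x - y| := by positivity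
    linarith
  · intro j
    simp only [Finset.mem_insert, Finset.mem_singleton, Finset.mem_Icc]
    omega

lemma abs_mul_le_odd (n : ℕ) (x y : ℝ) :
    2 * (|x| ^ (2 * n + 1) * |x - y|) ≤
      ∑ j ∈ Finset.Icc 1 (n + 1), radialCoeff (n + 1 - j) (2 * n + 1) *
        (|x ^ (2 * j - 1) - y ^ (2 * j - 1)| + 2 * (|x| ^ (2 * j - 1) * |x - y|)) := by
  have h0 : ∀ j, 1 ≤ j → 0 ≤ radialCoeff (n + 1 - j) (2 * n + 1) :=
    fun j hj => (radialCoeff_pos (by omega)).le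
  refine le_trans ?_ (Finset.single_le_sum (fun j hj =>
    mul_nonneg (h0 j (Finset.mem_Icc.1 hj).1) (by positivity))
    (Finset.mem_Icc.2 ⟨by omega, le_refl (n + 1)⟩))
  rw [Nat.sub_self, radialCoeff_zero, one_mul, show 2 * (n + 1) - 1 = 2 * n + 1 by omega]
  linarith [abs_nonneg (x ^ (2 * n + 1) - y ^ (2 * n + 1))]

lemma abs_steinTest_sub_le_even_bound {n : ℕ} (hn : 1 ≤ n) {h : ℝ → ℝ} (hh : LipschitzWith 1 h)
    (hz : ∫ t, h t * radialWeight (2 * n) t = 0) {x y : ℝ} (hx : x ≠ 0) (hy : y ≠ 0) :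
    |steinTest (2 * n) h x - steinTest (2 * n) h y| ≤
      (∑ j ∈ Finset.Icc 0 n, radialCoeff (n - j) (2 * n) *
        (|x ^ (2 * j) - y ^ (2 * j)| + 2 * (|x| ^ (2 * j) * |x - y|)))
      + ∑ j ∈ Finset.Icc 1 n, radialCoeff j (2 * n) *
        (|1 / x ^ (2 * j - 1) - 1 / y ^ (2 * j - 1)| + 1 / |x| ^ (2 * j - 1) * |x - y|) := by
  rw [sum_Icc_one_eq_sum_range]
  exact (abs_steinTest_sub_le_even hn hh hz hx hy).trans
    (add_le_add (two_add_abs_le_even hn x y) le_rfl)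

/-- From `2 + |x| ≤ 3 + |x|^{2n+1}`, the constant is absorbed by `6a` since `a ≥ 1`, and the power
by the top term of the first sum. The `5/2` is absorbed by 6. The terms with `1/|y|^{2n}` and with
`|x|^{2n+1}` in the last line are pure slack. -/
lemma abs_steinTest_sub_le_odd_bound {n : ℕ} (hn : 1 ≤ n) {h : ℝ → ℝ} (hh : LipschitzWith 1 h)
    (hz : ∫ t, h t * radialWeight (2 * n + 1) t = 0) {x y : ℝ} (hx : x ≠ 0) (hy : y ≠ 0) :
    |steinTest (2 * n + 1) h x - steinTest (2 * n + 1) h y| ≤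
      (∑ j ∈ Finset.Icc 1 (n + 1), radialCoeff (n + 1 - j) (2 * n + 1) *
        (|x ^ (2 * j - 1) - y ^ (2 * j - 1)| + 2 * (|x| ^ (2 * j - 1) * |x - y|)))
      + (∑ j ∈ Finset.Icc 1 n, radialCoeff j (2 * n + 1) *
        (|1 / x ^ (2 * j - 1) - 1 / y ^ (2 * j - 1)| + 1 / |x| ^ (2 * j - 1) * |x - y|))
      + 3 * radialCoeff (n + 1) (2 * n + 1)
        * ((2 + 2 / |x| ^ (2 * n) + 1 / |y| ^ (2 * n)) * |x - y|)
      + 3 * radialCoeff (n + 1) (2 * n + 1)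
        * ((|x| + |x| ^ (2 * n + 1)) * |1 / x ^ (2 * n + 1) - 1 / y ^ (2 * n + 1)|) := by
  rw [sum_Icc_one_eq_sum_range n]
  have h1 := abs_steinTest_sub_le_odd hn hh hz hx hy
  have h2 := abs_mul_le_odd n x y
  have ha := one_le_radialCoeff_odd n
  simp only [show ∀ i, 2 * (i + 1) - 1 = 2 * i + 1 by intro i; omega] at h1 ⊢
  set a := radialCoeff (n + 1) (2 * n + 1)
  have hd := abs_nonneg (x - y)
  have hxp : |x| ≤ 1 + |x| ^ (2 * n + 1) := by
    rcases le_total 1 |x| with h | h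
    · linarith [le_self_pow₀ h (show 2 * n + 1 ≠ 0 by omega)]
    · have : 0 ≤ |x| ^ (2 * n + 1) := by positivity
      linarith
  have h3 := mul_le_mul_of_nonneg_right hxp hd
  have h4 := mul_le_mul_of_nonneg_right ha hd
  have h5 : 0 ≤ |x| ^ (2 * n + 1) * |x - y| := by positivity
  have h6 : 0 ≤ a * (1 / |x| ^ (2 * n) * |x - y|) := by positivity
  have h7 : 0 ≤ a * (1 / |y| ^ (2 * n) * |x - y|) := by positivity
  have h8 : 0 ≤ a * (|x| ^ (2 * n + 1) * |1 / x ^ (2 * n + 1) - 1 / y ^ (2 * n + 1)|) := by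
    positivity
  have e1 : 3 * a * ((2 + 2 / |x| ^ (2 * n) + 1 / |y| ^ (2 * n)) * |x - y|)
      = 6 * (a * |x - y|) + 6 * (a * (1 / |x| ^ (2 * n) * |x - y|))
        + 3 * (a * (1 / |y| ^ (2 * n) * |x - y|)) := by ring
  have e2 : 3 * a * ((|x| + |x| ^ (2 * n + 1)) * |1 / x ^ (2 * n + 1) - 1 / y ^ (2 * n + 1)|)
      = 3 * (a * (|x| * |1 / x ^ (2 * n + 1) - 1 / y ^ (2 * n + 1)|))
        + 3 * (a * (|x| ^ (2 * n + 1) * |1 / x ^ (2 * n + 1) - 1 / y ^ (2 * n + 1)|)) := by ring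
  rw [e1, e2]
  linarith

/-! ### Assembly of the two bounds -/

section Main

variable {Ω : Type*} [MeasurableSpace Ω] {P : Measure Ω}

lemma nonnegExp_sum_mul_add_le (s : Finset ℕ) {c : ℕ → ℝ} (hc : ∀ i ∈ s, 0 ≤ c i) {d : ℝ}
    (hd : 0 ≤ d) {X Y : ℕ → Ω → ℝ} (hX : ∀ i, Measurable (X i)) (hY : ∀ i, Measurable (Y i)) :
    nonnegExp P (fun ω => ∑ i ∈ s, c i * (X i ω + d * Y i ω)) ≤
      ∑ i ∈ s, ENNReal.ofReal (c i) *
        (nonnegExp P (X i) + ENNReal.ofReal d * nonnegExp P (Y i)) := by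
  refine (nonnegExp_sum_le s fun i => by fun_prop).trans (Finset.sum_le_sum fun i hi => ?_)
  rw [nonnegExp_const_mul (hc i hi) (by fun_prop), ← nonnegExp_const_mul hd (hY i)]
  gcongr
  exact nonnegExp_add_le (hX i)

lemma ne_top_right_of_mul_ne_top {a b : ℝ≥0∞} (h : a * b ≠ ∞) (ha : a ≠ 0) : b ≠ ∞ :=
  (ENNReal.lt_top_of_mul_ne_top_right h ha).ne

lemma ne_top_of_sum_ne_top {s : Finset ℕ} {c : ℕ → ℝ} {X Y : ℕ → ℝ≥0∞}
    (h : ∑ i ∈ s, ENNReal.ofReal (c i) * (X i + Y i) ≠ ∞) {i : ℕ} (hi : i ∈ s) (hc : 0 < c i) :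
    X i ≠ ∞ ∧ Y i ≠ ∞ :=
  ENNReal.add_ne_top.1 (ne_top_right_of_mul_ne_top (ENNReal.sum_ne_top.1 h i hi)
    (ENNReal.ofReal_pos.2 hc).ne')

lemma integrable_of_integrable_sq [IsProbabilityMeasure P] {F : Ω → ℝ} (hF : Measurable F)
    (hF2 : Integrable (fun ω => F ω ^ 2) P) : Integrable F P := by
  refine ((integrable_const (1 : ℝ)).add hF2).mono' hF.aestronglyMeasurable
    (ae_of_all _ fun ω => ?_)
  simp only [Pi.add_apply, Real.norm_eq_abs]
  nlinarith [sq_nonneg (|F ω| - 1), sq_abs (F ω)]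

variable [IsProbabilityMeasure P] {F Fs : Ω → ℝ}

lemma wassersteinDist_le_even {l : ℕ} (hl : 1 ≤ l) (hF : Measurable F) (hFs : Measurable Fs)
    (hF0 : ∀ᵐ ω ∂P, F ω ≠ 0) (hF2 : Integrable (fun ω => F ω ^ 2) P)
    (hvar : ∫ ω, F ω ^ 2 ∂P = ((2 * l : ℕ) : ℝ) + 1) (hbias : IsRadialBias (2 * l) P F Fs) :
    wassersteinDist (P.map F) (radialMeasure (2 * l)) ≤
        (∑ j ∈ Finset.Icc 0 l, ENNReal.ofReal (radialCoeff (l - j) (2 * l)) *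
          (nonnegExp P (fun ω => |F ω ^ (2 * j) - Fs ω ^ (2 * j)|)
            + 2 * nonnegExp P (fun ω => |F ω| ^ (2 * j) * |F ω - Fs ω|)))
        + ∑ j ∈ Finset.Icc 1 l, ENNReal.ofReal (radialCoeff j (2 * l)) *
          (nonnegExp P (fun ω => |1 / F ω ^ (2 * j - 1) - 1 / Fs ω ^ (2 * j - 1)|)
            + nonnegExp P (fun ω => 1 / |F ω| ^ (2 * j - 1) * |F ω - Fs ω|)) := by
  -- Only a finite right-hand side needs an argument. Since the relevant coefficients are positive,
  -- finiteness passes to the individual expectations.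
  by_contra hlt
  have htop := ne_top_of_lt (not_le.1 hlt)
  refine hlt ?_
  obtain ⟨htop1, htop2⟩ := ENNReal.add_ne_top.1 htop
  have hFs0 := ae_ne_zero_of_isRadialBias (by omega) hFs hF0 hF2 hvar hbias
  have hF1 := integrable_of_integrable_sq hF hF2
  have hFs1 : Integrable Fs P := by
    refine integrable_of_integrable_of_sub hFs hF1 ?_ hF
    -- At `j = 0` the weight `|F|^0` is 1, so this term controls `E|F - F⋆|`.
    have h := (ne_top_of_sum_ne_top htop1 (i := 0) (by simp) (radialCoeff_pos (by omega))).2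
    have h' := ne_top_right_of_mul_ne_top h (by norm_num)
    simpa [abs_sub_comm] using h'
  obtain ⟨m, rfl⟩ : ∃ m, l = m + 1 := ⟨l - 1, by omega⟩
  obtain ⟨hFsi, hFi⟩ := integrable_inv_odd_pow hF hFs hF0 hF1 hvar hbias m (by omega)
    fun i hi => (ne_top_of_sum_ne_top htop2 (i := i + 1) (Finset.mem_Icc.2 (by omega))
      (radialCoeff_pos (by omega))).1
  refine (wassersteinDist_le_of_isRadialBias (k := 2 * m + 1) hF hFs hF0 hFs0 hF1 hFs1 hFi hFsi hvar
    hbias fun h hh hz ω h1 h2 => abs_steinTest_sub_le_even_bound hl hh hz h1 h2).trans ?_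
  refine (nonnegExp_add_le (by fun_prop)).trans (add_le_add ?_ ?_)
  · refine (nonnegExp_sum_mul_add_le _ (fun j _ => (radialCoeff_pos (by omega)).le) (by norm_num)
      (fun j => by fun_prop) fun j => by fun_prop).trans (le_of_eq ?_)
    simp
  · have := nonnegExp_sum_mul_add_le (P := P) (Finset.Icc 1 (m + 1))
      (c := fun j => radialCoeff j (2 * (m + 1)))
      (fun j hj => (radialCoeff_pos (by have := (Finset.mem_Icc.1 hj).2; omega)).le) zero_le_one
      (X := fun j ω => |1 / F ω ^ (2 * j - 1) - 1 / Fs ω ^ (2 * j - 1)|)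
      (Y := fun j ω => 1 / |F ω| ^ (2 * j - 1) * |F ω - Fs ω|)
      (fun j => by fun_prop) fun j => by fun_prop
    simpa only [one_mul, ENNReal.ofReal_one] using this

lemma wassersteinDist_le_odd {n : ℕ} (hn : 1 ≤ n) (hF : Measurable F) (hFs : Measurable Fs)
    (hF0 : ∀ᵐ ω ∂P, F ω ≠ 0) (hF2 : Integrable (fun ω => F ω ^ 2) P)
    (hvar : ∫ ω, F ω ^ 2 ∂P = ((2 * n + 1 : ℕ) : ℝ) + 1)
    (hbias : IsRadialBias (2 * n + 1) P F Fs) :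
    wassersteinDist (P.map F) (radialMeasure (2 * n + 1)) ≤
        (∑ j ∈ Finset.Icc 1 (n + 1), ENNReal.ofReal (radialCoeff (n + 1 - j) (2 * n + 1)) *
          (nonnegExp P (fun ω => |F ω ^ (2 * j - 1) - Fs ω ^ (2 * j - 1)|)
            + 2 * nonnegExp P (fun ω => |F ω| ^ (2 * j - 1) * |F ω - Fs ω|)))
        + (∑ j ∈ Finset.Icc 1 n, ENNReal.ofReal (radialCoeff j (2 * n + 1)) *
          (nonnegExp P (fun ω => |1 / F ω ^ (2 * j - 1) - 1 / Fs ω ^ (2 * j - 1)|)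
            + nonnegExp P (fun ω => 1 / |F ω| ^ (2 * j - 1) * |F ω - Fs ω|)))
        + 3 * ENNReal.ofReal (radialCoeff (n + 1) (2 * n + 1)) *
          nonnegExp P (fun ω => (2 + 2 / |F ω| ^ (2 * n) + 1 / |Fs ω| ^ (2 * n))
            * |F ω - Fs ω|)
        + 3 * ENNReal.ofReal (radialCoeff (n + 1) (2 * n + 1)) *
          nonnegExp P (fun ω => (|F ω| + |F ω| ^ (2 * n + 1))
            * |1 / F ω ^ (2 * n + 1) - 1 / Fs ω ^ (2 * n + 1)|) := by
  by_contra hlt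
  have htop := ne_top_of_lt (not_le.1 hlt)
  refine hlt ?_
  obtain ⟨htop123, htop4⟩ := ENNReal.add_ne_top.1 htop
  obtain ⟨htop12, -⟩ := ENNReal.add_ne_top.1 htop123
  obtain ⟨htop1, htop2⟩ := ENNReal.add_ne_top.1 htop12
  have ha : 0 < radialCoeff (n + 1) (2 * n + 1) := radialCoeff_pos (by omega)
  have hFs0 := ae_ne_zero_of_isRadialBias (by omega) hFs hF0 hF2 hvar hbias
  have hF1 := integrable_of_integrable_sq hF hF2
  have hFs1 : Integrable Fs P := by
    refine integrable_of_integrable_of_sub hFs hF1 ?_ hF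
    have h := (ne_top_of_sum_ne_top htop1 (i := 1) (by simp) (radialCoeff_pos (by omega))).1
    simpa [abs_sub_comm] using h
  have h4 : nonnegExp P (fun ω => |F ω| * |1 / F ω ^ (2 * n + 1) - 1 / Fs ω ^ (2 * n + 1)|) ≠ ∞ := by
    refine ne_top_of_le_ne_top (ne_top_right_of_mul_ne_top htop4
      (mul_ne_zero (by norm_num) (ENNReal.ofReal_pos.2 ha).ne')) (nonnegExp_mono fun ω => ?_)
    exact mul_le_mul_of_nonneg_right (le_add_of_nonneg_right (by positivity)) (abs_nonneg _)
  obtain ⟨hFsi, hFi⟩ := integrable_inv_even_pow hn rfl hF hFs hF0 hFs0 hF1 hvar hbias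
    (fun i hi => (ne_top_of_sum_ne_top htop2 (i := i + 1) (Finset.mem_Icc.2 (by omega))
      (radialCoeff_pos (by omega))).1) h4
  refine (wassersteinDist_le_of_isRadialBias (k := 2 * n) hF hFs hF0 hFs0 hF1 hFs1 hFi hFsi hvar
    hbias fun h hh hz ω h1 h2 => abs_steinTest_sub_le_odd_bound hn hh hz h1 h2).trans ?_
  have e3 : 3 * ENNReal.ofReal (radialCoeff (n + 1) (2 * n + 1))
      = ENNReal.ofReal (3 * radialCoeff (n + 1) (2 * n + 1)) := by
    rw [ENNReal.ofReal_mul (by norm_num)]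
    simp
  rw [e3, ← nonnegExp_const_mul (by positivity) (by fun_prop),
    ← nonnegExp_const_mul (by positivity) (by fun_prop)]
  refine (nonnegExp_add_le (by fun_prop)).trans (add_le_add ?_ le_rfl)
  refine (nonnegExp_add_le (by fun_prop)).trans (add_le_add ?_ le_rfl)
  refine (nonnegExp_add_le (by fun_prop)).trans (add_le_add ?_ ?_)
  · refine (nonnegExp_sum_mul_add_le _ (fun j hj => (radialCoeff_pos
      (by have := (Finset.mem_Icc.1 hj).1; omega)).le) (by norm_num)
      (fun j => by fun_prop) fun j => by fun_prop).trans (le_of_eq ?_)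
    simp
  · have := nonnegExp_sum_mul_add_le (P := P) (Finset.Icc 1 n)
      (c := fun j => radialCoeff j (2 * n + 1))
      (fun j hj => (radialCoeff_pos (by have := (Finset.mem_Icc.1 hj).2; omega)).le) zero_le_one
      (X := fun j ω => |1 / F ω ^ (2 * j - 1) - 1 / Fs ω ^ (2 * j - 1)|)
      (Y := fun j ω => 1 / |F ω| ^ (2 * j - 1) * |F ω - Fs ω|)
      (fun j => by fun_prop) fun j => by fun_prop
    simpa only [one_mul, ENNReal.ofReal_one] using this

end Main

theorem mainTheorem8 {Ω : Type*} [MeasurableSpace Ω] (P : Measure Ω) [IsProbabilityMeasure P]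
    (k : ℕ) (hk : 2 ≤ k) (F Fs : Ω → ℝ) (hF : Measurable F) (hFs : Measurable Fs)
    (hF0 : ∀ᵐ ω ∂P, F ω ≠ 0)
    (hF2 : Integrable (fun ω => F ω ^ 2) P) (hvar : ∫ ω, F ω ^ 2 ∂P = (k : ℝ) + 1)
    (hbias : IsRadialBias k P F Fs) :
    (∀ l : ℕ, k = 2 * l →
      wassersteinDist (P.map F) (radialMeasure k) ≤
        (∑ j ∈ Finset.Icc 0 l, ENNReal.ofReal (radialCoeff (l - j) (2 * l)) *
          (nonnegExp P (fun ω => |F ω ^ (2 * j) - Fs ω ^ (2 * j)|)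
            + 2 * nonnegExp P (fun ω => |F ω| ^ (2 * j) * |F ω - Fs ω|)))
        + ∑ j ∈ Finset.Icc 1 l, ENNReal.ofReal (radialCoeff j (2 * l)) *
          (nonnegExp P (fun ω => |1 / F ω ^ (2 * j - 1) - 1 / Fs ω ^ (2 * j - 1)|)
            + nonnegExp P (fun ω => 1 / |F ω| ^ (2 * j - 1) * |F ω - Fs ω|))) ∧
    (∀ l : ℕ, k = 2 * l - 1 →
      wassersteinDist (P.map F) (radialMeasure k) ≤
        (∑ j ∈ Finset.Icc 1 l, ENNReal.ofReal (radialCoeff (l - j) (2 * l - 1)) *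
          (nonnegExp P (fun ω => |F ω ^ (2 * j - 1) - Fs ω ^ (2 * j - 1)|)
            + 2 * nonnegExp P (fun ω => |F ω| ^ (2 * j - 1) * |F ω - Fs ω|)))
        + (∑ j ∈ Finset.Icc 1 (l - 1), ENNReal.ofReal (radialCoeff j (2 * l - 1)) *
          (nonnegExp P (fun ω => |1 / F ω ^ (2 * j - 1) - 1 / Fs ω ^ (2 * j - 1)|)
            + nonnegExp P (fun ω => 1 / |F ω| ^ (2 * j - 1) * |F ω - Fs ω|)))
        + 3 * ENNReal.ofReal (radialCoeff l (2 * l - 1)) *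
          nonnegExp P (fun ω => (2 + 2 / |F ω| ^ (2 * (l - 1)) + 1 / |Fs ω| ^ (2 * (l - 1)))
            * |F ω - Fs ω|)
        + 3 * ENNReal.ofReal (radialCoeff l (2 * l - 1)) *
          nonnegExp P (fun ω => (|F ω| + |F ω| ^ (2 * l - 1))
            * |1 / F ω ^ (2 * l - 1) - 1 / Fs ω ^ (2 * l - 1)|)) := by
  refine ⟨?_, ?_⟩
  · rintro l rfl
    exact wassersteinDist_le_even (by omega) hF hFs hF0 hF2 hvar hbias
  · intro l hl
    -- `k ≥ 2` rules out `l = 0`, where `2 * l - 1` truncates to 0, and also `l = 1`, so `n ≥ 1`.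
    obtain ⟨n, rfl⟩ : ∃ n, l = n + 1 := ⟨l - 1, by omega⟩
    obtain rfl : k = 2 * n + 1 := by omega
    simp only [Nat.add_sub_cancel, show 2 * (n + 1) - 1 = 2 * n + 1 by omega]
    exact wassersteinDist_le_odd (by omega) hF hFs hF0 hF2 hvar hbias
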